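/- **Conventions.** Let $mon$ (resp. $gr$) be the category of finitely generated free monoids (resp. groups), in its skeletal form: the objects are the natural numbers $k$, and $\mathrm{Hom}(k,l)$ is the set of monoid homomorphisms between the free monoids (resp. group homomorphisms between the free groups) on $k$ and $l$ letters. Write $0$ for the trivial homomorphism, which is the zero morphism. Groupification $\mathbf g\colon mon\to gr$ is the identity on objects and sends $f$ to the unique group homomorphism $\mathbf g(f)$ with $\mathbf g(f)\circ\eta_k=\eta_l\circ f$, where $\eta_k$ is the canonical map from the free monoid to the free group on $k$ letters. Let $A$ be a set with operations $\theta\colon A^m\to A$, $\theta\in\mathcal P(m)$, $m\ge 0$. Let $\bar\theta\colon \mathbb Z[A]^{\otimes m}\to\mathbb Z[A]$ be the linear extension of $\theta$, let $I(A)$ be the kernel of the augmentation $\mathbb Z[A]\to\mathbb Z$, and put $$I^{n}_{\mathcal P}(A)=\sum_{m\ge n}\ \sum_{\theta\in\mathcal P(m)}\bar\theta\big(I(A)^{\otimes m}\big),\qquad P_n^{\mathcal P}(A)=I(A)/I_{\mathcal P}^{n+1}(A).$$ For a monoid $A$ and $\mathcal P=\mathcal As$, the elements of $\mathcal As(m)=\mathfrak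 S_m$ act by $(a_1,\dots,a_m)\mapsto a_{\sigma(1)}\cdots a_{\sigma(m)}$. For a group $A$ and the theory $\mathbb Gr$ of groups, the $m$-ary operations are all words $w$ in the free group on $m$ letters, acting by $(a_1,\dots,a_m)\mapsto w(a_1,\dots,a_m)$. In both cases $\mathrm{Hom}(k,Y)\cong Y^k$ carries the pointwise operations. The preadditive category $P_n^{\mathcal As}mon$ has the objects of $mon$, the morphism groups $P_n^{\mathcal As}(\mathrm{Hom}_{mon}(k,l))$, and the bilinear composition with $p_n(g)\circ p_n(f)=p_n(g\circ f)$, where $p_n(f)$ is the class of $f-0$. The category $P_n^{\mathbb Gr}gr$ is defined in the same way. Let $\underline p_n^{\mathcal As}\colon mon\to P_n^{\mathcal As}mon$ and $\underline p_n^{\mathbb Gr}\colon gr\to P_n^{\mathbb Gr}gr$ be the functors that are the identity on objects and send $f$ to $p_n(f)$. For a category $\mathcal C$ with zero morphisms and finite coproducts, let $U_X(Y)=\mathbb Z[\mathrm{Hom}_{\mathcal C}(X,Y)]/\mathbb Z\cdot 0$, a functor of $Y$. For a functor $F\colon\mathcal C\to Ab$, let $T_nF(Y)$ be the cokernel of $cr_{n+1}F(Y,\dots,Y)\hookrightarrow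 F(Y\vee\dots\vee Y)\to F(Y)$. Here the second map is induced by the folding map, and $cr_{n+1}F(Y,\dots,Y)$ is the common kernel of the $n+1$ maps $F(Y^{\vee (n+1)})\to F(Y^{\vee n})$ that kill one summand. The preadditive category $T_n\bar{\mathbb Z}[\mathcal C]$ has the objects of $\mathcal C$, the morphism groups $T_nU_X(Y)$, and the composition induced by that of $\mathcal C$. Let $\underline t_n\colon\mathcal C\to T_n\bar{\mathbb Z}[\mathcal C]$ be the canonical functor. **Theorem.** Let $n\ge 0$. 1. There is a unique additive functor $P_n\mathbf g\colon P_n^{\mathcal As}mon\to P_n^{\mathbb Gr}gr$ with $P_n\mathbf g\circ\underline p_n^{\mathcal As}=\underline p_n^{\mathbb Gr}\circ\mathbf g$, and it is an isomorphism of preadditive categories. 2. There is an isomorphism of preadditive categories $T_n\mathbf g\colon T_n\bar{\mathbb Z}[mon]\to T_n\bar{\mathbb Z}[gr]$ with $T_n\mathbf g\circ\underline t_n=\underline t_n\circ\mathbf g$. It corresponds to $P_n\mathbf g$ under isomorphisms of preadditive categories $\Phi\colon T_n\bar{\mathbb Z}[mon]\cong P_n^{\mathcal As}mon$ and $\Psi\colon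 T_n\bar{\mathbb Z}[gr]\cong P_n^{\mathbb Gr}gr$ with $\Phi\circ\underline t_n=\underline p_n^{\mathcal As}$ and $\Psi\circ\underline t_n=\underline p_n^{\mathbb Gr}$; that is, $P_n\mathbf g\circ\Phi=\Psi\circ T_n\mathbf g$. -/

import Mathlib

open CategoryTheory CategoryTheory.Limits

namespace PolyFun

/-! ## Free abelian groups on sets, multilinear extensions, generalized Passi groups -/

/-- The augmentation `ℤ[A] → ℤ`, sending every basis element to `1`. -/
def aug (A : Type*) : FreeAbelianGroup A →+ ℤ := FreeAbelianGroup.lift fun _ => 1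

/-- `I(A)`, the kernel of the augmentation `ℤ[A] → ℤ`. -/
def augKer (A : Type*) : AddSubgroup (FreeAbelianGroup A) := (aug A).ker

/-- The extension `θ̄ : ℤ[A] ⊗ ⋯ ⊗ ℤ[A] → ℤ[B]` of an `m`-ary operation `θ : Aᵐ → B`, as a function
of `m` arguments: it is additive in each argument and sends `(a₁, …, a_m)` with `aᵢ ∈ A` to the
basis element `θ (a₁, …, a_m)`. -/
def multiExt {A B : Type*} : ∀ {m : ℕ}, ((Fin m → A) → B) → (Fin m → FreeAbelianGroup A) →
    FreeAbelianGroup B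
  | 0, θ, _ => FreeAbelianGroup.of (θ Fin.elim0)
  | _ + 1, θ, x =>
      FreeAbelianGroup.lift (fun a => multiExt (fun v => θ (Fin.cons a v)) (Fin.tail x)) (x 0)

/-- `I^n_𝒫(A) = ∑_{m ≥ n} ∑_{θ ∈ 𝒫(m)} θ̄(I(A)^{⊗ m})`, for a set `A` on which the elements of
`𝒫(m)` act as `m`-ary operations. -/
def opPow {A : Type*} {P : ℕ → Type*} (μ : ∀ m, P m → (Fin m → A) → A) (n : ℕ) :
    AddSubgroup (FreeAbelianGroup A) :=
  AddSubgroup.closure {y | ∃ m, n ≤ m ∧ ∃ (θ : P m) (x : Fin m → FreeAbelianGroup A),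
    (∀ i, x i ∈ augKer A) ∧ y = multiExt (μ m θ) x}

/-- The operations of a monoid as an algebra over the unitary associative operad `𝒜s`, for which
`𝒜s(m) = 𝔖_m`: the permutation `σ` acts as `(a₁, …, a_m) ↦ a_{σ 1} ⋯ a_{σ m}`. -/
def asOp {M : Type*} [Monoid M] (m : ℕ) (σ : Equiv.Perm (Fin m)) (a : Fin m → M) : M :=
  (List.ofFn fun i => a (σ i)).prod

/-- The operations of a group as an algebra over the operad of the theory of groups, whose set of
`m`-ary operations `Hom(m, 1)` is the free group on `m` letters: a word `w` acts as
`(a₁, …, a_m) ↦ w(a₁, …, a_m)`. -/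
def grOp {G : Type*} [Group G] (m : ℕ) (w : FreeGroup (Fin m)) (a : Fin m → G) : G :=
  FreeGroup.lift a w

/-! ### Auxiliary facts: the operadic powers of `I` are the powers of the augmentation ideal -/

section Aux

open FreeAbelianGroup

@[simp] theorem aug_of {A : Type*} (a : A) : aug A (of a) = 1 := by simp [aug]

theorem mem_augKer {A : Type*} {x : FreeAbelianGroup A} : x ∈ augKer A ↔ aug A x = 0 := Iff.rfl

@[simp] theorem aug_map {A B : Type*} (f : A → B) (x : FreeAbelianGroup A) :
    aug B (map f x) = aug A x := by
  have : (aug B).comp (map f) = aug A := FreeAbelianGroup.lift_ext _ _ fun a => by simp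
  exact DFunLike.congr_fun this x

theorem multiExt_of {A B : Type*} {m : ℕ} (θ : (Fin m → A) → B) (a : Fin m → A) :
    multiExt θ (fun i => of (a i)) = of (θ a) := by
  induction m with
  | zero => simp [multiExt, Subsingleton.elim a Fin.elim0]
  | succ m ih =>
    simp only [multiExt, lift_apply_of]
    have := ih (fun v => θ (Fin.cons (a 0) v)) (Fin.tail a)
    rw [Fin.cons_self_tail] at this
    exact this

theorem multiExt_eq_map {A B : Type*} {m : ℕ} (θ : (Fin m → A) → B)
    (x : Fin m → FreeAbelianGroup A) : multiExt θ x = map θ (multiExt id x) := by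
  suffices h : ∀ {C : Type _} {m : ℕ} (φ : (Fin m → A) → C) (θ : C → B) (x),
      multiExt (fun v => θ (φ v)) x = map θ (multiExt φ x) from h id θ x
  clear x θ m
  intro C m φ θ x
  induction m with
  | zero => simp [multiExt]
  | succ m ih =>
    simp only [multiExt]
    rw [← AddMonoidHom.comp_apply]
    congr 1
    refine FreeAbelianGroup.lift_ext _ _ fun a => ?_
    simp [ih (fun v => φ (Fin.cons a v))]

variable {M N L : Type*} [Monoid M] [Monoid N] [Monoid L]

/-- The augmentation ideal of `ℤ[M]`, as a (two-sided) ideal. -/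
def augIdeal (M : Type*) [Monoid M] : Ideal (FreeAbelianGroup M) :=
  RingHom.ker (liftMonoid (1 : M →* ℤ))

instance : (augIdeal M).IsTwoSided := by unfold augIdeal; infer_instance

theorem mem_pow_zero {x : FreeAbelianGroup M} : x ∈ augIdeal M ^ 0 := by
  rw [Submodule.pow_zero, Ideal.one_eq_top]; trivial

theorem mem_augIdeal {x : FreeAbelianGroup M} : x ∈ augIdeal M ↔ aug M x = 0 := Iff.rfl

theorem map_mul_of_hom (f : M →* N) (x y : FreeAbelianGroup M) :
    map f (x * y) = map f x * map f y := by
  have h : ∀ z, map f z = liftMonoid (ofMulHom.comp f) z := fun z => rfl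
  rw [h, h, h, map_mul]

theorem of_sub_one_mem (m : M) : of m - 1 ∈ augIdeal M := by
  rw [mem_augIdeal, FreeAbelianGroup.one_def]; simp

/-- An element of `I^{s+1}` is a sum of elements `(m - 1) z` with `z ∈ I^s`. -/
theorem pow_succ_induction {s : ℕ} (S : AddSubgroup (FreeAbelianGroup M))
    (h : ∀ (m : M) (z), z ∈ augIdeal M ^ s → (of m - 1) * z ∈ S) {y : FreeAbelianGroup M}
    (hy : y ∈ augIdeal M ^ (s + 1)) : y ∈ S := by
  rw [Ideal.IsTwoSided.pow_succ] at hy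
  refine Submodule.mul_induction_on hy (fun r hr z hz => ?_) (fun _ _ => S.add_mem)
  suffices H : ∀ r : FreeAbelianGroup M, (r - (aug M r) • (1 : FreeAbelianGroup M)) * z ∈ S by
    have := H r
    rwa [mem_augIdeal.1 hr, zero_smul, sub_zero] at this
  intro r
  induction r using FreeAbelianGroup.induction_on with
  | zero => simp
  | of m => simpa using h m z hz
  | neg m ih =>
    have : (-of m - (aug M (-of m)) • (1 : FreeAbelianGroup M)) * z
        = -((of m - (aug M (of m)) • (1 : FreeAbelianGroup M)) * z) := by
      simp only [map_neg, neg_smul]; noncomm_ring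
    rw [this]; exact S.neg_mem ih
  | add x y hx hy =>
    have : (x + y - (aug M (x + y)) • (1 : FreeAbelianGroup M)) * z
        = (x - (aug M x) • (1 : FreeAbelianGroup M)) * z
          + (y - (aug M y) • (1 : FreeAbelianGroup M)) * z := by
      simp only [map_add, add_smul]; noncomm_ring
    rw [this]; exact S.add_mem hx hy

/-- `f` is of filtration degree `r` if its linear extension sends `I(M)^t` to `I(N)^{t+r}`. -/
def Filt (r : ℕ) (f : M → FreeAbelianGroup N) : Prop :=
  ∀ t, ∀ z ∈ augIdeal M ^ t, lift f z ∈ augIdeal N ^ (t + r)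

theorem lift_sub_one_mul (f : M → FreeAbelianGroup N) (m : M) (z : FreeAbelianGroup M) :
    lift f ((of m - 1) * z) = lift (fun x => f (m * x) - f x) z := by
  let A : FreeAbelianGroup M →+ FreeAbelianGroup N :=
    (lift f).comp (AddMonoidHom.mulLeft (of m - 1))
  have : A = lift (fun x => f (m * x) - f x) := by
    refine FreeAbelianGroup.lift_ext _ _ fun a => ?_
    simp [A, sub_mul, FreeAbelianGroup.of_mul_of]
  exact DFunLike.congr_fun this z

theorem Filt.diff {r : ℕ} {f : M → FreeAbelianGroup N} (hf : Filt r f) (m : M) :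
    Filt (r + 1) (fun x => f (m * x) - f x) := by
  intro t z hz
  rw [← lift_sub_one_mul, ← add_assoc, add_right_comm]
  refine hf (t + 1) _ ?_
  rw [Ideal.IsTwoSided.pow_succ]
  exact Ideal.mul_mem_mul (of_sub_one_mem m) hz

theorem Filt.mul {r r' : ℕ} {f g : M → FreeAbelianGroup N} (hf : Filt r f) (hg : Filt r' g) :
    Filt (r + r') (fun x => f x * g x) := by
  intro t
  induction t generalizing r r' f g with
  | zero =>
    intro z _
    induction z using FreeAbelianGroup.induction_on with
    | zero => simp
    | of m =>
      have h1 := hf 0 (of m) mem_pow_zero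
      have h2 := hg 0 (of m) mem_pow_zero
      simp only [lift_apply_of, zero_add] at h1 h2 ⊢
      rw [Ideal.IsTwoSided.pow_add]; exact Ideal.mul_mem_mul h1 h2
    | neg m ih => rw [map_neg]; exact neg_mem (ih mem_pow_zero)
    | add x y hx hy =>
      rw [map_add]; exact add_mem (hx mem_pow_zero) (hy mem_pow_zero)
  | succ t ih =>
    intro z hz
    refine pow_succ_induction
      ((Submodule.toAddSubgroup (augIdeal N ^ (t + 1 + (r + r')))).comap
        (lift (fun x => f x * g x))) (fun m w hw => ?_) hz
    change lift (fun x => f x * g x) ((of m - 1) * w) ∈ augIdeal N ^ (t + 1 + (r + r'))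
    rw [lift_sub_one_mul]
    have h1 := ih (hf.diff m) hg w hw
    have h2 := ih hf (hg.diff m) w hw
    have h3 := ih (hf.diff m) (hg.diff m) w hw
    have e : (fun x => f (m * x) * g (m * x) - f x * g x)
        = (fun x => (f (m * x) - f x) * g x) + (fun x => f x * (g (m * x) - g x))
          + (fun x => (f (m * x) - f x) * (g (m * x) - g x)) := by
      funext x; simp only [Pi.add_apply]; noncomm_ring
    rw [e, lift_add, lift_add]
    simp only [AddMonoidHom.add_apply]
    refine add_mem (add_mem ?_ ?_) ?_
    · convert h1 using 2; ring
    · convert h2 using 2; ring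
    · exact Ideal.pow_le_pow_right (by omega) h3

/-- The maps of sets whose linear extensions send `I(M)^t` to `I(N)^t`, for all `t`. -/
def IsFilt (f : M → N) : Prop := ∀ t, ∀ z ∈ augIdeal M ^ t, map f z ∈ augIdeal N ^ t

theorem isFilt_iff (f : M → N) : IsFilt f ↔ Filt 0 (fun x => of (f x)) := Iff.rfl

theorem IsFilt.mul {f g : M → N} (hf : IsFilt f) (hg : IsFilt g) : IsFilt (fun x => f x * g x) := by
  rw [isFilt_iff] at *
  simpa only [FreeAbelianGroup.of_mul_of] using Filt.mul hf hg

theorem isFilt_hom (f : M →* N) : IsFilt f := by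
  intro t
  induction t with
  | zero => exact fun z _ => mem_pow_zero
  | succ t ih =>
    intro z hz
    refine pow_succ_induction ((Submodule.toAddSubgroup (augIdeal N ^ (t + 1))).comap (map f))
      (fun m w hw => ?_) hz
    change map f ((of m - 1) * w) ∈ augIdeal N ^ (t + 1)
    rw [map_mul_of_hom, map_sub, map_of_apply, FreeAbelianGroup.one_def, map_of_apply, map_one,
      ← FreeAbelianGroup.one_def, Ideal.IsTwoSided.pow_succ]
    exact Ideal.mul_mem_mul (of_sub_one_mem _) (ih w hw)

theorem IsFilt.one : IsFilt (fun _ : M => (1 : N)) := isFilt_hom (1 : M →* N)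

theorem IsFilt.comp {f : M → N} {g : N → L} (hg : IsFilt g) (hf : IsFilt f) :
    IsFilt (fun x => g (f x)) := by
  intro t z hz
  have := hg t _ (hf t z hz)
  rwa [← map_comp_apply] at this

theorem IsFilt.inv {G : Type*} [Group G] {f : M → G} (hf : IsFilt f) :
    IsFilt (fun x => (f x)⁻¹) := by
  refine IsFilt.comp (g := fun x : G => x⁻¹) ?_ hf
  rw [isFilt_iff]
  suffices H : ∀ t r (c : FreeAbelianGroup G), c ∈ augIdeal G ^ r → ∀ z ∈ augIdeal G ^ t,
      lift (fun x : G => of x⁻¹ * c) z ∈ augIdeal G ^ (t + r) by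
    intro t z hz
    simpa using H t 0 1 mem_pow_zero z hz
  intro t
  induction t with
  | zero =>
    intro r c hc z _
    induction z using FreeAbelianGroup.induction_on with
    | zero => simp
    | of m => rw [lift_apply_of, zero_add]; exact Ideal.mul_mem_left _ _ hc
    | neg m ih => rw [map_neg]; exact neg_mem (ih mem_pow_zero)
    | add x y hx hy =>
      rw [map_add]; exact add_mem (hx mem_pow_zero) (hy mem_pow_zero)
  | succ t ih =>
    intro r c hc z hz
    refine pow_succ_induction
      ((Submodule.toAddSubgroup (augIdeal G ^ (t + 1 + r))).comap
        (lift (fun x : G => of x⁻¹ * c))) (fun m w hw => ?_) hz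
    change lift (fun x : G => of x⁻¹ * c) ((of m - 1) * w) ∈ augIdeal G ^ (t + 1 + r)
    rw [lift_sub_one_mul]
    have hc' : (of m⁻¹ - 1) * c ∈ augIdeal G ^ (r + 1) := by
      rw [Ideal.IsTwoSided.pow_succ]; exact Ideal.mul_mem_mul (of_sub_one_mem _) hc
    have := ih (r + 1) _ hc' w hw
    have e : (fun x : G => of (m * x)⁻¹ * c - of x⁻¹ * c)
        = fun x : G => of x⁻¹ * ((of m⁻¹ - 1) * c) := by
      funext x
      rw [mul_inv_rev, FreeAbelianGroup.of_mul]; noncomm_ring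
    rw [e]
    convert this using 2; ring

theorem IsFilt.listProd {m : ℕ} {f : Fin m → M → N} (hf : ∀ i, IsFilt (f i)) :
    IsFilt (fun x => (List.ofFn fun i => f i x).prod) := by
  induction m with
  | zero => simpa using IsFilt.one
  | succ m ih =>
    simp only [List.ofFn_succ, List.prod_cons]
    exact (hf 0).mul (ih fun i => hf i.succ)

/-- The inclusion `M^m → M^{m+1}` with first component `1`. -/
def consOne (M : Type*) [Monoid M] (m : ℕ) : (Fin m → M) →* (Fin (m + 1) → M) where
  toFun v := Fin.cons 1 v
  map_one' := by funext i; refine Fin.cases ?_ (fun _ => ?_) i <;> simp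
  map_mul' u v := by funext i; refine Fin.cases ?_ (fun _ => ?_) i <;> simp

theorem IsFilt.pi {k : ℕ} {f : M → Fin k → N} (hf : ∀ i, IsFilt (fun x => f x i)) :
    IsFilt f := by
  induction k with
  | zero => convert IsFilt.one (M := M) (N := Fin 0 → N)
  | succ k ih =>
    have e : f = fun x => (Pi.mulSingle 0 (f x 0) : Fin (k + 1) → N)
        * consOne N k (fun i => f x i.succ) := by
      funext x i
      refine Fin.cases ?_ (fun j => ?_) i <;> simp [consOne]
    rw [e]
    exact ((isFilt_hom (MonoidHom.mulSingle (fun _ => N) 0)).comp (hf 0)).mul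
      ((isFilt_hom (consOne N k)).comp (ih fun i => hf i.succ))

theorem multiExt_id_mem {m : ℕ} (x : Fin m → FreeAbelianGroup M) (hx : ∀ i, x i ∈ augKer M) :
    multiExt id x ∈ augIdeal (Fin m → M) ^ m := by
  induction m with
  | zero => exact mem_pow_zero
  | succ m ih =>
    let a : M →* (Fin (m + 1) → M) := MonoidHom.mulSingle (fun _ => M) 0
    let b := consOne M m
    have key : multiExt id x = map a (x 0) * map b (multiExt id (Fin.tail x)) := by
      simp only [multiExt]
      let A : FreeAbelianGroup M →+ FreeAbelianGroup (Fin (m + 1) → M) :=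
        (AddMonoidHom.mulRight (map b (multiExt id (Fin.tail x)))).comp (map a)
      change _ = A (x 0)
      congr 1
      refine FreeAbelianGroup.lift_ext _ _ fun c => ?_
      simp only [lift_apply_of, A, AddMonoidHom.comp_apply, map_of_apply,
        AddMonoidHom.mulRight_apply]
      rw [multiExt_eq_map]
      generalize multiExt id (Fin.tail x) = y
      let B : FreeAbelianGroup (Fin m → M) →+ FreeAbelianGroup (Fin (m + 1) → M) :=
        (AddMonoidHom.mulLeft (of (a c))).comp (map b)
      change _ = B y
      congr 1
      refine FreeAbelianGroup.lift_ext _ _ fun v => ?_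
      simp only [map_of_apply, B, AddMonoidHom.comp_apply, AddMonoidHom.coe_mulLeft,
        FreeAbelianGroup.of_mul_of]
      congr 1
      funext i
      refine Fin.cases ?_ (fun j => ?_) i <;> simp [a, b, consOne]
    rw [key, Ideal.IsTwoSided.pow_succ]
    refine Ideal.mul_mem_mul ?_ (isFilt_hom b m _ (ih _ fun i => hx i.succ))
    rw [mem_augIdeal, aug_map]; exact hx 0

theorem multiExt_prod {m : ℕ} (x : Fin m → FreeAbelianGroup M) :
    multiExt (fun v : Fin m → M => (List.ofFn v).prod) x = (List.ofFn x).prod := by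
  induction m with
  | zero => simp [multiExt, FreeAbelianGroup.one_def]
  | succ m ih =>
    have h2 : ∀ a : M, multiExt (fun v : Fin m → M => (List.ofFn (Fin.cons a v : Fin (m+1) → M)).prod)
        (Fin.tail x) = of a * (List.ofFn (Fin.tail x)).prod := by
      intro a
      rw [← ih]
      have : ∀ v : Fin m → M, (List.ofFn (Fin.cons a v : Fin (m+1) → M)).prod
          = a * (List.ofFn v).prod := by intro v; simp [List.ofFn_succ]
      simp only [this]
      rw [multiExt_eq_map, multiExt_eq_map (fun v : Fin m → M => (List.ofFn v).prod)]
      generalize multiExt id (Fin.tail x) = y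
      induction y using FreeAbelianGroup.induction_on with
      | zero => simp
      | of m => simp [FreeAbelianGroup.of_mul_of]
      | neg m ih => simp [ih]
      | add x y hx hy => simp [mul_add, hx, hy]
    simp only [multiExt, h2]
    rw [List.ofFn_succ, List.prod_cons]
    change _ = AddMonoidHom.mulRight (List.ofFn (Fin.tail x)).prod (x 0)
    congr 1
    exact FreeAbelianGroup.lift_ext _ _ fun a => by simp

theorem opPow_eq {P : ℕ → Type*} (μ : ∀ m, P m → (Fin m → M) → M)
    (h1 : ∀ m θ, IsFilt (μ m θ)) (h2 : ∀ m, ∃ θ, ∀ a, μ m θ a = (List.ofFn a).prod) (n : ℕ)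
    (y : FreeAbelianGroup M) : y ∈ opPow μ (n + 1) ↔ y ∈ augIdeal M ^ (n + 1) := by
  constructor
  · intro hy
    refine (AddSubgroup.closure_le (Submodule.toAddSubgroup (augIdeal M ^ (n + 1)))).2 ?_ hy
    rintro _ ⟨m, hm, θ, x, hx, rfl⟩
    rw [multiExt_eq_map]
    exact Ideal.pow_le_pow_right hm (h1 m θ m _ (multiExt_id_mem x hx))
  · intro hy
    suffices H : y ∈ AddSubgroup.closure {y : FreeAbelianGroup M |
        ∃ x : Fin (n + 1) → FreeAbelianGroup M,
        (∀ i, x i ∈ augKer M) ∧ y = (List.ofFn x).prod} by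
      refine AddSubgroup.closure_mono ?_ H
      rintro _ ⟨x, hx, rfl⟩
      obtain ⟨θ, hθ⟩ := h2 (n + 1)
      refine ⟨n + 1, le_rfl, θ, x, hx, ?_⟩
      rw [← multiExt_prod]; congr 1; funext a; exact (hθ a).symm
    induction n generalizing y with
    | zero =>
      refine AddSubgroup.subset_closure ⟨fun _ => y, fun _ => ?_, by simp⟩
      rw [zero_add, Submodule.pow_one] at hy
      exact hy
    | succ n ih =>
      refine pow_succ_induction _ (fun m z hz => ?_) hy
      have := ih z hz
      refine (AddSubgroup.closure_le ((AddSubgroup.closure _).comap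
        (AddMonoidHom.mulLeft (of m - 1)))).2 ?_ this
      rintro _ ⟨x, hx, rfl⟩
      refine AddSubgroup.subset_closure ⟨Fin.cons (of m - 1) x, ?_, ?_⟩
      · intro i
        refine Fin.cases ?_ (fun j => ?_) i
        · exact of_sub_one_mem m
        · simpa using hx j
      · simp [List.ofFn_succ]

end Aux

/-! ## Preadditive categories attached to a category -/

section Generic

universe v u

open FreeAbelianGroup

/-- A two-sided ideal of a preadditive category. -/
structure AddIdeal (D : Type u) [Category.{v} D] [Preadditive D] where
  carrier : ∀ X Y : D, AddSubgroup (X ⟶ Y)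
  comp_left : ∀ {X Y Z : D} (f : X ⟶ Y) (g : Y ⟶ Z), g ∈ carrier Y Z → f ≫ g ∈ carrier X Z
  comp_right : ∀ {X Y Z : D} (f : X ⟶ Y) (g : Y ⟶ Z), f ∈ carrier X Y → f ≫ g ∈ carrier X Z

/-- The quotient of a preadditive category by a two-sided ideal: same objects, and the morphism
groups are the quotient groups. -/
structure QuotCat {D : Type u} [Category.{v} D] [Preadditive D] (K : AddIdeal D) where
  obj : D

namespace QuotCat

variable {D : Type u} [Category.{v} D] [Preadditive D] (K : AddIdeal D)

/-- Composition in the quotient category, `[f] ≫ [g] = [f ≫ g]`. -/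
def comp (X Y Z : D) : ((X ⟶ Y) ⧸ K.carrier X Y) →+ ((Y ⟶ Z) ⧸ K.carrier Y Z) →+
    ((X ⟶ Z) ⧸ K.carrier X Z) :=
  QuotientAddGroup.lift _
    { toFun := fun f => QuotientAddGroup.map _ _ (Preadditive.leftComp Z f)
        (fun g hg => K.comp_left f g hg)
      map_zero' := by
        ext g; simp [Preadditive.leftComp]
      map_add' := fun f f' => by
        ext g; simp [Preadditive.leftComp] }
    (fun f hf => by
      ext g
      exact (QuotientAddGroup.eq_zero_iff _).2 (K.comp_right f g hf))

instance : Category (QuotCat K) where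
  Hom X Y := (X.obj ⟶ Y.obj) ⧸ K.carrier X.obj Y.obj
  id X := ((𝟙 X.obj : X.obj ⟶ X.obj) : (X.obj ⟶ X.obj) ⧸ K.carrier X.obj X.obj)
  comp {X Y Z} f g := comp K X.obj Y.obj Z.obj f g
  id_comp {X Y} f := by
    induction f using QuotientAddGroup.induction_on with
    | H f => exact congrArg _ (Category.id_comp f)
  comp_id {X Y} f := by
    induction f using QuotientAddGroup.induction_on with
    | H f => exact congrArg _ (Category.comp_id f)
  assoc {W X Y Z} f g h := by
    induction f using QuotientAddGroup.induction_on with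
    | H f =>
    induction g using QuotientAddGroup.induction_on with
    | H g =>
    induction h using QuotientAddGroup.induction_on with
    | H h => exact congrArg _ (Category.assoc f g h)

instance : Preadditive (QuotCat K) where
  homGroup X Y := inferInstanceAs (AddCommGroup ((X.obj ⟶ Y.obj) ⧸ K.carrier X.obj Y.obj))
  add_comp X Y Z f f' g := DFunLike.congr_fun ((comp K X.obj Y.obj Z.obj).map_add f f') g
  comp_add X Y Z f g g' := (comp K X.obj Y.obj Z.obj f).map_add g g'

/-- The quotient functor. -/
def proj : D ⥤ QuotCat K where
  obj X := ⟨X⟩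
  map {X Y} f := (f : (X ⟶ Y) ⧸ K.carrier X Y)
  map_id _ := rfl
  map_comp _ _ := rfl

end QuotCat

variable {C : Type u} [Category.{v} C]

/-- The bilinear extension of composition to free abelian groups. -/
def zcomp (X Y Z : C) :
    FreeAbelianGroup (X ⟶ Y) →+ FreeAbelianGroup (Y ⟶ Z) →+ FreeAbelianGroup (X ⟶ Z) :=
  lift fun f => map fun g => f ≫ g

@[simp] theorem zcomp_of_of {X Y Z : C} (f : X ⟶ Y) (g : Y ⟶ Z) :
    zcomp X Y Z (of f) (of g) = of (f ≫ g) := by simp [zcomp]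

theorem zcomp_of_left {X Y Z : C} (f : X ⟶ Y) (y : FreeAbelianGroup (Y ⟶ Z)) :
    zcomp X Y Z (of f) y = map (fun g => f ≫ g) y := by simp [zcomp]

theorem zcomp_of_right {X Y Z : C} (x : FreeAbelianGroup (X ⟶ Y)) (g : Y ⟶ Z) :
    zcomp X Y Z x (of g) = map (fun f => f ≫ g) x := by
  have : (zcomp X Y Z).flip (of g) = map (fun f => f ≫ g) :=
    FreeAbelianGroup.lift_ext _ _ fun f => by simp
  exact DFunLike.congr_fun this x

theorem zcomp_assoc {W X Y Z : C} (x : FreeAbelianGroup (W ⟶ X)) (y : FreeAbelianGroup (X ⟶ Y))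
    (z : FreeAbelianGroup (Y ⟶ Z)) :
    zcomp W Y Z (zcomp W X Y x y) z = zcomp W X Z x (zcomp X Y Z y z) := by
  induction x using FreeAbelianGroup.induction_on with
  | zero => simp
  | neg _ ih => simp only [map_neg, AddMonoidHom.neg_apply, ih]
  | add _ _ h1 h2 => simp only [map_add, AddMonoidHom.add_apply, h1, h2]
  | of f =>
  induction y using FreeAbelianGroup.induction_on with
  | zero => simp
  | neg _ ih => simp only [map_neg, AddMonoidHom.neg_apply, ih]
  | add _ _ h1 h2 => simp only [map_add, AddMonoidHom.add_apply, h1, h2]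
  | of g =>
  induction z using FreeAbelianGroup.induction_on with
  | zero => simp
  | neg _ ih => simp only [map_neg, ih]
  | add _ _ h1 h2 => simp only [map_add, h1, h2]
  | of h => simp

theorem aug_zcomp {X Y Z : C} (x : FreeAbelianGroup (X ⟶ Y)) (y : FreeAbelianGroup (Y ⟶ Z)) :
    aug _ (zcomp X Y Z x y) = aug _ x * aug _ y := by
  induction x using FreeAbelianGroup.induction_on with
  | zero => simp
  | neg _ ih => simp only [map_neg, AddMonoidHom.neg_apply, ih]; ring
  | add _ _ h1 h2 => simp only [map_add, AddMonoidHom.add_apply, h1, h2]; ring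
  | of f => rw [zcomp_of_left, aug_map]; simp

/-- The category `ℤ[C]`: same objects as `C`, and morphism groups `ℤ[Hom(X, Y)]`. -/
structure ZCat (C : Type u) where
  obj : C

instance : Category (ZCat C) where
  Hom X Y := FreeAbelianGroup (X.obj ⟶ Y.obj)
  id X := of (𝟙 X.obj)
  comp {X Y Z} f g := zcomp X.obj Y.obj Z.obj f g
  id_comp {X Y} f := by
    rw [zcomp_of_left]; simp only [Category.id_comp]; exact map_id_apply f
  comp_id {X Y} f := by
    rw [zcomp_of_right]; simp only [Category.comp_id]; exact map_id_apply f
  assoc {W X Y Z} f g h := zcomp_assoc f g h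

instance : Preadditive (ZCat C) where
  homGroup X Y := inferInstanceAs (AddCommGroup (FreeAbelianGroup (X.obj ⟶ Y.obj)))
  add_comp X Y Z f f' g := DFunLike.congr_fun ((zcomp X.obj Y.obj Z.obj).map_add f f') g
  comp_add X Y Z f g g' := (zcomp X.obj Y.obj Z.obj f).map_add g g'

variable [HasZeroMorphisms C]

theorem zcomp_zero_right {X Y Z : C} (x : FreeAbelianGroup (X ⟶ Y)) :
    zcomp X Y Z x (of 0) = aug _ x • of 0 := by
  induction x using FreeAbelianGroup.induction_on with
  | zero => simp
  | neg _ ih => simp only [map_neg, AddMonoidHom.neg_apply, ih, neg_smul]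
  | add _ _ h1 h2 => simp only [map_add, AddMonoidHom.add_apply, h1, h2, add_smul]
  | of f => simp

theorem zcomp_zero_left {X Y Z : C} (y : FreeAbelianGroup (Y ⟶ Z)) :
    zcomp X Y Z (of 0) y = aug _ y • of 0 := by
  induction y using FreeAbelianGroup.induction_on with
  | zero => simp
  | neg _ ih => simp only [map_neg, ih, neg_smul]
  | add _ _ h1 h2 => simp only [map_add, h1, h2, add_smul]
  | of f => simp

/-! ### The augmentation category: morphism groups `I(Hom(X, Y))` -/

/-- Same objects as `C`, morphism groups `I(Hom(X, Y)) ⊆ ℤ[Hom(X, Y)]`, and the bilinear composition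
of `ℤ[C]`; it satisfies `(g - 0) ∘ (f - 0) = g ∘ f - 0`, so that the identity of `X` is
`id_X - 0`. -/
structure AugCat (C : Type u) where
  obj : C

instance : Category (AugCat C) where
  Hom X Y := augKer (X.obj ⟶ Y.obj)
  id X := ⟨of (𝟙 X.obj) - of 0, by simp [mem_augKer]⟩
  comp {X Y Z} f g := ⟨zcomp X.obj Y.obj Z.obj f.1 g.1, by
    rw [mem_augKer, aug_zcomp, mem_augKer.1 f.2, zero_mul]⟩
  id_comp {X Y} f := by
    apply Subtype.ext
    change zcomp _ _ _ (of (𝟙 X.obj) - of 0) f.1 = f.1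
    rw [map_sub, AddMonoidHom.sub_apply, zcomp_zero_left, mem_augKer.1 f.2, zero_smul, sub_zero,
      zcomp_of_left]
    simp only [Category.id_comp]; exact map_id_apply f.1
  comp_id {X Y} f := by
    apply Subtype.ext
    change zcomp _ _ _ f.1 (of (𝟙 Y.obj) - of 0) = f.1
    rw [map_sub, zcomp_zero_right, mem_augKer.1 f.2, zero_smul, sub_zero, zcomp_of_right]
    simp only [Category.comp_id]; exact map_id_apply f.1
  assoc {W X Y Z} f g h := Subtype.ext (zcomp_assoc f.1 g.1 h.1)

instance : Preadditive (AugCat C) where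
  homGroup X Y := inferInstanceAs (AddCommGroup (augKer (X.obj ⟶ Y.obj)))
  add_comp X Y Z f f' g := Subtype.ext <|
    DFunLike.congr_fun (map_add (zcomp X.obj Y.obj Z.obj) f.1 f'.1) g.1
  comp_add X Y Z f g g' := Subtype.ext <| map_add (zcomp X.obj Y.obj Z.obj f.1) g.1 g'.1

/-- The functor `C → AugCat C`, `f ↦ f - 0`. -/
def augFunctor (C : Type u) [Category.{v} C] [HasZeroMorphisms C] : C ⥤ AugCat C where
  obj X := ⟨X⟩
  map {X Y} f := ⟨of f - of 0, by simp [mem_augKer]⟩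
  map_id _ := rfl
  map_comp {X Y Z} f g := by
    apply Subtype.ext
    change of (f ≫ g) - of 0 = zcomp _ _ _ (of f - of 0) (of g - of 0)
    simp

/-! ### The reduced category `ℤ̄[C]` and the universal functors -/

/-- The ideal `ℤ[0]` of `ℤ[C]`, spanned by the zero morphisms. -/
def zeroIdeal (C : Type u) [Category.{v} C] [HasZeroMorphisms C] : AddIdeal (ZCat C) where
  carrier X Y := AddSubgroup.zmultiples (of (0 : X.obj ⟶ Y.obj) : FreeAbelianGroup _)
  comp_left {X Y Z} f g hg := by
    obtain ⟨k, rfl⟩ := AddSubgroup.mem_zmultiples_iff.1 hg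
    change zcomp X.obj Y.obj Z.obj f (k • of 0) ∈ _
    rw [map_zsmul, zcomp_zero_right, smul_smul]
    exact AddSubgroup.zsmul_mem_zmultiples _ _
  comp_right {X Y Z} f g hf := by
    obtain ⟨k, rfl⟩ := AddSubgroup.mem_zmultiples_iff.1 hf
    change zcomp X.obj Y.obj Z.obj (k • of 0) g ∈ _
    rw [map_zsmul, AddMonoidHom.smul_apply, zcomp_zero_left, smul_smul]
    exact AddSubgroup.zsmul_mem_zmultiples _ _

/-- The category `ℤ̄[C]`, with morphism groups `U_X(Y) = ℤ[Hom(X, Y)] / ℤ[0]`. -/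
abbrev ZRed (C : Type u) [Category.{v} C] [HasZeroMorphisms C] := QuotCat (zeroIdeal C)

/-- The functor `C → ℤ̄[C]` sending `f` to its class. -/
def zredFunctor (C : Type u) [Category.{v} C] [HasZeroMorphisms C] : C ⥤ ZRed C where
  obj X := ⟨⟨X⟩⟩
  map {X Y} f := ((of f : FreeAbelianGroup (X ⟶ Y)) :
    FreeAbelianGroup (X ⟶ Y) ⧸ AddSubgroup.zmultiples (of (0 : X ⟶ Y)))
  map_id _ := rfl
  map_comp {X Y Z} f g := by
    refine congrArg _ ?_
    exact (zcomp_of_of f g).symm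

/-- The universal functor `U_X : C → Ab`, `Y ↦ ℤ[Hom(X, Y)] / ℤ[0]`. -/
def univFunctor (X : C) : C ⥤ AddCommGrpCat.{v} :=
  zredFunctor C ⋙ preadditiveCoyoneda.obj (Opposite.op ((zredFunctor C).obj X))

/-! ### Cross-effects and Taylorisation -/

variable [HasFiniteCoproducts C]

/-- The retraction `r_k̂ : X₀ ∨ ⋯ ∨ X_m → X₀ ∨ ⋯ X̂_k ⋯ ∨ X_m` which is zero on `X_k`. -/
noncomputable def omitMap {m : ℕ} (X : Fin (m + 1) → C) (k : Fin (m + 1)) :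
    (∐ X) ⟶ ∐ fun j => X (k.succAbove j) :=
  Sigma.desc (Fin.insertNth (α := fun i => X i ⟶ ∐ fun j => X (k.succAbove j)) k 0
    fun j => Sigma.ι (fun j => X (k.succAbove j)) j)

/-- The cross-effect `cr_{m+1} F(X₀, …, X_m)`, the subgroup of `F(X₀ ∨ ⋯ ∨ X_m)` of the elements
killed by all the maps `F(r_k̂)`. -/
noncomputable def crossEffect (F : C ⥤ AddCommGrpCat.{v}) {m : ℕ} (X : Fin (m + 1) → C) :
    AddSubgroup (F.obj (∐ X)) :=
  ⨅ k, (F.map (omitMap X k)).hom.ker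

/-- The image of `S_{n+1}^F : cr_{n+1}F(X, …, X) → F(X ∨ ⋯ ∨ X) → F(X)`, the second map being
induced by the folding map. The Taylorisation is `T_n F(X) = F(X) ⧸ taylorKer F n X`. -/
noncomputable def taylorKer (F : C ⥤ AddCommGrpCat.{v}) (n : ℕ) (X : C) : AddSubgroup (F.obj X) :=
  (crossEffect F fun _ : Fin (n + 1) => X).map (F.map (Sigma.desc fun _ => 𝟙 X)).hom

theorem omitMap_natural {m : ℕ} {X Y : C} (g : X ⟶ Y) (k : Fin (m + 1)) :
    Limits.Sigma.map (fun _ => g) ≫ omitMap (fun _ : Fin (m + 1) => Y) k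
      = omitMap (fun _ : Fin (m + 1) => X) k ≫ Limits.Sigma.map (fun _ => g) := by
  refine Sigma.hom_ext _ _ fun i => ?_
  refine Fin.succAboveCases k ?_ (fun j => ?_) i
  · simp [omitMap]
  · simp [omitMap]

theorem taylorKer_map (F : C ⥤ AddCommGrpCat.{v}) (n : ℕ) {X Y : C} (g : X ⟶ Y) {x : F.obj X}
    (hx : x ∈ taylorKer F n X) : (F.map g).hom x ∈ taylorKer F n Y := by
  obtain ⟨z, hz, rfl⟩ := hx
  refine ⟨(F.map (Limits.Sigma.map fun _ => g)).hom z, ?_, ?_⟩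
  · refine (AddSubgroup.mem_iInf).2 fun k => ?_
    have hk : (F.map (omitMap _ k)).hom z = 0 := (AddSubgroup.mem_iInf).1 hz k
    change (F.map (omitMap _ k)).hom ((F.map (Limits.Sigma.map fun _ => g)).hom z) = 0
    rw [← AddCommGrpCat.comp_apply, ← F.map_comp, omitMap_natural, F.map_comp,
      AddCommGrpCat.comp_apply, hk, map_zero]
  · rw [← AddCommGrpCat.comp_apply, ← AddCommGrpCat.comp_apply, ← F.map_comp, ← F.map_comp]
    congr 3
    refine Sigma.hom_ext _ _ fun i => ?_
    simp

theorem taylorKer_app {F G : C ⥤ AddCommGrpCat.{v}} (α : F ⟶ G) (n : ℕ) {X : C} {x : F.obj X}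
    (hx : x ∈ taylorKer F n X) : (α.app X).hom x ∈ taylorKer G n X := by
  obtain ⟨z, hz, rfl⟩ := hx
  refine ⟨(α.app _).hom z, ?_, ?_⟩
  · refine (AddSubgroup.mem_iInf).2 fun k => ?_
    have hk : (F.map (omitMap _ k)).hom z = 0 := (AddSubgroup.mem_iInf).1 hz k
    change (G.map (omitMap _ k)).hom ((α.app _).hom z) = 0
    rw [← AddCommGrpCat.comp_apply, ← α.naturality, AddCommGrpCat.comp_apply, hk, map_zero]
  · rw [← AddCommGrpCat.comp_apply, ← AddCommGrpCat.comp_apply, α.naturality]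

/-- The subgroups of `U_X(Y)` by which one divides to get `T_n U_X(Y)` form an ideal of `ℤ̄[C]`. -/
noncomputable def taylorIdeal (C : Type u) [Category.{v} C] [HasZeroMorphisms C]
    [HasFiniteCoproducts C] (n : ℕ) : AddIdeal (ZRed C) where
  carrier X Y := taylorKer (univFunctor X.obj.obj) n Y.obj.obj
  comp_left f _ hg :=
    taylorKer_app (Functor.whiskerLeft (zredFunctor C) (preadditiveCoyoneda.map f.op)) n hg
  comp_right {X Y Z} f g hf := by
    induction g using QuotientAddGroup.induction_on with
    | H g =>
      let A : FreeAbelianGroup (Y.obj.obj ⟶ Z.obj.obj) →+ (X ⟶ Z) :=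
        (Preadditive.leftComp Z f).comp (QuotientAddGroup.mk' _)
      change A g ∈ (taylorKer (univFunctor X.obj.obj) n Z.obj.obj : AddSubgroup (X ⟶ Z))
      induction g using FreeAbelianGroup.induction_on with
      | zero => rw [map_zero]; exact zero_mem _
      | of g => exact taylorKer_map (univFunctor X.obj.obj) n g hf
      | neg g ih => rw [map_neg]; exact neg_mem ih
      | add g g' ih ih' => rw [map_add]; exact add_mem ih ih'

/-- The preadditive category `T_n ℤ̄[C]`: same objects as `C`, morphism groups
`T_n U_X(Y)`, composition induced by that of `C`. -/
abbrev TZ (C : Type u) [Category.{v} C] [HasZeroMorphisms C] [HasFiniteCoproducts C] (n : ℕ) :=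
  QuotCat (taylorIdeal C n)

/-- The functor `t_n : C → T_n ℤ̄[C]`, the identity on objects, `f ↦ t_n f` on morphisms. -/
noncomputable def tFunctor (C : Type u) [Category.{v} C] [HasZeroMorphisms C]
    [HasFiniteCoproducts C] (n : ℕ) : C ⥤ TZ C n :=
  zredFunctor C ⋙ QuotCat.proj (taylorIdeal C n)

end Generic

/-! ## The categories `mon` and `gr`, and groupification -/

/-- The category `mon` of finitely generated free monoids: an object is a natural number `k`,
standing for the free monoid on `k` letters, and morphisms are monoid homomorphisms. -/
structure FMon where
  rank : ℕ

/-- The category `gr` of finitely generated free groups: an object is a natural number `k`,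
standing for the free group on `k` letters, and morphisms are group homomorphisms. -/
structure FGrp where
  rank : ℕ

instance : Category FMon where
  Hom X Y := FreeMonoid (Fin X.rank) →* FreeMonoid (Fin Y.rank)
  id X := MonoidHom.id _
  comp f g := MonoidHom.comp g f

instance : Category FGrp where
  Hom X Y := FreeGroup (Fin X.rank) →* FreeGroup (Fin Y.rank)
  id X := MonoidHom.id _
  comp f g := MonoidHom.comp g f

/-- A morphism of `mon`, as a homomorphism. -/
def FMon.hom {X Y : FMon} (f : X ⟶ Y) : FreeMonoid (Fin X.rank) →* FreeMonoid (Fin Y.rank) := f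

/-- A morphism of `gr`, as a homomorphism. -/
def FGrp.hom {X Y : FGrp} (f : X ⟶ Y) : FreeGroup (Fin X.rank) →* FreeGroup (Fin Y.rank) := f

/-- A homomorphism of free monoids, as a morphism of `mon`. -/
def FMon.mk' {X Y : FMon} (f : FreeMonoid (Fin X.rank) →* FreeMonoid (Fin Y.rank)) : X ⟶ Y := f

/-- A homomorphism of free groups, as a morphism of `gr`. -/
def FGrp.mk' {X Y : FGrp} (f : FreeGroup (Fin X.rank) →* FreeGroup (Fin Y.rank)) : X ⟶ Y := f

theorem FMon.hom_ext {X Y : FMon} {f g : X ⟶ Y}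
    (h : ∀ i, FMon.hom f (FreeMonoid.of i) = FMon.hom g (FreeMonoid.of i)) : f = g :=
  FreeMonoid.hom_eq h

theorem FGrp.hom_ext {X Y : FGrp} {f g : X ⟶ Y}
    (h : ∀ i, FGrp.hom f (FreeGroup.of i) = FGrp.hom g (FreeGroup.of i)) : f = g :=
  FreeGroup.ext_hom _ _ h

instance : HasZeroMorphisms FMon where
  zero _ _ := ⟨FMon.mk' 1⟩
  comp_zero _ _ := rfl
  zero_comp _ _ _ g := MonoidHom.ext fun _ => map_one (FMon.hom g)

instance : HasZeroMorphisms FGrp where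
  zero _ _ := ⟨FGrp.mk' 1⟩
  comp_zero _ _ := rfl
  zero_comp _ _ _ g := MonoidHom.ext fun _ => map_one (FGrp.hom g)

/-- The coproduct of the free objects on `k` and on `l` letters is the one on `k + l` letters. -/
instance : HasFiniteCoproducts FMon := by
  have : HasInitial FMon := IsInitial.hasInitial (X := ⟨0⟩) <|
    IsInitial.ofUniqueHom (fun _ => 0) fun _ _ => FMon.hom_ext fun i => i.elim0
  have : ∀ X Y : FMon, HasColimit (pair X Y) := fun X Y => by
    let inl : X ⟶ (⟨X.rank + Y.rank⟩ : FMon) :=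
      FMon.mk' (FreeMonoid.lift fun i => FreeMonoid.of (Fin.castAdd Y.rank i))
    let inr : Y ⟶ (⟨X.rank + Y.rank⟩ : FMon) :=
      FMon.mk' (FreeMonoid.lift fun i => FreeMonoid.of (Fin.natAdd X.rank i))
    have hl : ∀ {Z} (h : (⟨X.rank + Y.rank⟩ : FMon) ⟶ Z) (i : Fin X.rank),
        FMon.hom (inl ≫ h) (FreeMonoid.of i) = FMon.hom h (FreeMonoid.of (Fin.castAdd Y.rank i)) :=
      fun h i => congrArg (FMon.hom h) (FreeMonoid.lift_eval_of _ _)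
    have hr : ∀ {Z} (h : (⟨X.rank + Y.rank⟩ : FMon) ⟶ Z) (i : Fin Y.rank),
        FMon.hom (inr ≫ h) (FreeMonoid.of i) = FMon.hom h (FreeMonoid.of (Fin.natAdd X.rank i)) :=
      fun h i => congrArg (FMon.hom h) (FreeMonoid.lift_eval_of _ _)
    let d : ∀ {Z : FMon}, (X ⟶ Z) → (Y ⟶ Z) → ((⟨X.rank + Y.rank⟩ : FMon) ⟶ Z) := fun f g =>
      FMon.mk' (FreeMonoid.lift (Fin.addCases (fun i => FMon.hom f (FreeMonoid.of i))
        fun i => FMon.hom g (FreeMonoid.of i)))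
    have dl : ∀ {Z} (f : X ⟶ Z) (g : Y ⟶ Z) (i : Fin X.rank),
        FMon.hom (d f g) (FreeMonoid.of (Fin.castAdd Y.rank i)) = FMon.hom f (FreeMonoid.of i) :=
      fun f g i => Eq.trans (FreeMonoid.lift_eval_of _ _) (Fin.addCases_left i)
    have dr : ∀ {Z} (f : X ⟶ Z) (g : Y ⟶ Z) (i : Fin Y.rank),
        FMon.hom (d f g) (FreeMonoid.of (Fin.natAdd X.rank i)) = FMon.hom g (FreeMonoid.of i) :=
      fun f g i => Eq.trans (FreeMonoid.lift_eval_of _ _) (Fin.addCases_right i)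
    have du : ∀ {Z} (f : X ⟶ Z) (g : Y ⟶ Z) (m : (⟨X.rank + Y.rank⟩ : FMon) ⟶ Z),
        inl ≫ m = f → inr ≫ m = g → m = d f g := fun f g m h1 h2 => by
      refine FMon.hom_ext fun i => ?_
      refine Fin.addCases (fun i => ?_) (fun i => ?_) i
      · rw [dl, ← h1]; exact (hl m i).symm
      · rw [dr, ← h2]; exact (hr m i).symm
    exact HasColimit.mk ⟨BinaryCofan.mk inl inr, BinaryCofan.IsColimit.mk _ d
      (fun f g => FMon.hom_ext fun i => (hl _ i).trans (dl f g i))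
      (fun f g => FMon.hom_ext fun i => (hr _ i).trans (dr f g i)) du⟩
  have : HasBinaryCoproducts FMon := hasBinaryCoproducts_of_hasColimit_pair FMon
  exact hasFiniteCoproducts_of_has_binary_and_initial

/-- The coproduct of the free objects on `k` and on `l` letters is the one on `k + l` letters. -/
instance : HasFiniteCoproducts FGrp := by
  have : HasInitial FGrp := IsInitial.hasInitial (X := ⟨0⟩) <|
    IsInitial.ofUniqueHom (fun _ => 0) fun _ _ => FGrp.hom_ext fun i => i.elim0
  have : ∀ X Y : FGrp, HasColimit (pair X Y) := fun X Y => by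
    let inl : X ⟶ (⟨X.rank + Y.rank⟩ : FGrp) :=
      FGrp.mk' (FreeGroup.lift fun i => FreeGroup.of (Fin.castAdd Y.rank i))
    let inr : Y ⟶ (⟨X.rank + Y.rank⟩ : FGrp) :=
      FGrp.mk' (FreeGroup.lift fun i => FreeGroup.of (Fin.natAdd X.rank i))
    have hl : ∀ {Z} (h : (⟨X.rank + Y.rank⟩ : FGrp) ⟶ Z) (i : Fin X.rank),
        FGrp.hom (inl ≫ h) (FreeGroup.of i) = FGrp.hom h (FreeGroup.of (Fin.castAdd Y.rank i)) :=
      fun h i => congrArg (FGrp.hom h) FreeGroup.lift_apply_of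
    have hr : ∀ {Z} (h : (⟨X.rank + Y.rank⟩ : FGrp) ⟶ Z) (i : Fin Y.rank),
        FGrp.hom (inr ≫ h) (FreeGroup.of i) = FGrp.hom h (FreeGroup.of (Fin.natAdd X.rank i)) :=
      fun h i => congrArg (FGrp.hom h) FreeGroup.lift_apply_of
    let d : ∀ {Z : FGrp}, (X ⟶ Z) → (Y ⟶ Z) → ((⟨X.rank + Y.rank⟩ : FGrp) ⟶ Z) := fun f g =>
      FGrp.mk' (FreeGroup.lift (Fin.addCases (fun i => FGrp.hom f (FreeGroup.of i))
        fun i => FGrp.hom g (FreeGroup.of i)))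
    have dl : ∀ {Z} (f : X ⟶ Z) (g : Y ⟶ Z) (i : Fin X.rank),
        FGrp.hom (d f g) (FreeGroup.of (Fin.castAdd Y.rank i)) = FGrp.hom f (FreeGroup.of i) :=
      fun f g i => Eq.trans FreeGroup.lift_apply_of (Fin.addCases_left i)
    have dr : ∀ {Z} (f : X ⟶ Z) (g : Y ⟶ Z) (i : Fin Y.rank),
        FGrp.hom (d f g) (FreeGroup.of (Fin.natAdd X.rank i)) = FGrp.hom g (FreeGroup.of i) :=
      fun f g i => Eq.trans FreeGroup.lift_apply_of (Fin.addCases_right i)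
    have du : ∀ {Z} (f : X ⟶ Z) (g : Y ⟶ Z) (m : (⟨X.rank + Y.rank⟩ : FGrp) ⟶ Z),
        inl ≫ m = f → inr ≫ m = g → m = d f g := fun f g m h1 h2 => by
      refine FGrp.hom_ext fun i => ?_
      refine Fin.addCases (fun i => ?_) (fun i => ?_) i
      · rw [dl, ← h1]; exact (hl m i).symm
      · rw [dr, ← h2]; exact (hr m i).symm
    exact HasColimit.mk ⟨BinaryCofan.mk inl inr, BinaryCofan.IsColimit.mk _ d
      (fun f g => FGrp.hom_ext fun i => (hl _ i).trans (dl f g i))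
      (fun f g => FGrp.hom_ext fun i => (hr _ i).trans (dr f g i)) du⟩
  have : HasBinaryCoproducts FGrp := hasBinaryCoproducts_of_hasColimit_pair FGrp
  exact hasFiniteCoproducts_of_has_binary_and_initial

/-- The canonical map from the free monoid to the free group on the same letters. -/
def etaFree (α : Type*) : FreeMonoid α →* FreeGroup α := FreeMonoid.lift FreeGroup.of

/-- `etaFree α` exhibits the free group on `α` as the groupification of the free monoid on `α`. -/
theorem etaFree_universal (α : Type*) {H : Type*} [Group H] (f : FreeMonoid α →* H) :
    ∃! h : FreeGroup α →* H, h.comp (etaFree α) = f := by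
  refine ⟨FreeGroup.lift fun a => f (FreeMonoid.of a), ?_, fun h hh => ?_⟩
  · exact FreeMonoid.hom_eq fun a => by simp [etaFree]
  · refine FreeGroup.ext_hom _ _ fun a => ?_
    rw [← hh]; simp [etaFree]

/-- Groupification of a homomorphism between free monoids, the homomorphism `g f` of free groups
such that `g f ∘ η = η ∘ f`. -/
def groupifyHom {α β : Type*} (f : FreeMonoid α →* FreeMonoid β) : FreeGroup α →* FreeGroup β :=
  FreeGroup.lift fun a => etaFree β (f (FreeMonoid.of a))

theorem groupifyHom_comp_eta {α β : Type*} (f : FreeMonoid α →* FreeMonoid β) :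
    (groupifyHom f).comp (etaFree α) = (etaFree β).comp f :=
  FreeMonoid.hom_eq fun a => by simp [etaFree, groupifyHom]

theorem groupifyHom_apply {α β : Type*} (f : FreeMonoid α →* FreeMonoid β) (w : FreeMonoid α) :
    groupifyHom f (etaFree α w) = etaFree β (f w) :=
  DFunLike.congr_fun (groupifyHom_comp_eta f) w

/-- The groupification functor `g : mon → gr`. -/
def groupification : FMon ⥤ FGrp where
  obj X := ⟨X.rank⟩
  map f := groupifyHom (FMon.hom f)
  map_id X := FreeGroup.ext_hom _ _ fun a => by
    change FreeGroup.lift _ (FreeGroup.of a) = FreeGroup.of a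
    rw [FreeGroup.lift_apply_of]
    exact FreeMonoid.lift_eval_of _ _
  map_comp {X Y Z} f g := FreeGroup.ext_hom _ _ fun a => by
    change FreeGroup.lift _ (FreeGroup.of a)
      = groupifyHom (FMon.hom g) (FreeGroup.lift _ (FreeGroup.of a))
    rw [FreeGroup.lift_apply_of, FreeGroup.lift_apply_of, groupifyHom_apply]
    rfl

/-! ## The categories `P_n^{As} mon` and `P_n^{Gr} gr` -/

/-- The structure of an algebra over `𝒜s` (that is, of a monoid) on `Hom(k, Y)`, transported along
the bijection `Hom(k, Y) ≅ Yᵏ`, `f ↦ (f 1, …, f k)`. -/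
def monOp (X Y : FMon) (m : ℕ) (σ : Equiv.Perm (Fin m)) (f : Fin m → (X ⟶ Y)) : X ⟶ Y :=
  FMon.mk' <| FreeMonoid.lift fun i => asOp m σ fun j => FMon.hom (f j) (FreeMonoid.of i)

/-- The structure of a group, as an algebra over the operad of the theory of groups, on `Hom(k, Y)`,
transported along the bijection `Hom(k, Y) ≅ Yᵏ`, `f ↦ (f 1, …, f k)`. -/
def grpOp (X Y : FGrp) (m : ℕ) (w : FreeGroup (Fin m)) (f : Fin m → (X ⟶ Y)) : X ⟶ Y :=
  FGrp.mk' <| FreeGroup.lift fun i => grOp m w fun j => FGrp.hom (f j) (FreeGroup.of i)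

section Passi

universe v u w

open FreeAbelianGroup

/-- The subgroups `I_𝒫^{n+1}(Hom(X, Y)) ⊆ I(Hom(X, Y))`, for operations on the sets of morphisms of
`C` such that these subgroups are stable under composition with morphisms of `C`. -/
def passiIdeal {C : Type u} [Category.{v} C] [HasZeroMorphisms C] {P : ℕ → Type w}
    (μ : ∀ X Y : C, ∀ m, P m → (Fin m → (X ⟶ Y)) → (X ⟶ Y)) (n : ℕ)
    (hl : ∀ {X Y Z : C} (f : X ⟶ Y), ∀ y ∈ opPow (μ Y Z) (n + 1),
      map (fun g => f ≫ g) y ∈ opPow (μ X Z) (n + 1))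
    (hr : ∀ {X Y Z : C} (g : Y ⟶ Z), ∀ y ∈ opPow (μ X Y) (n + 1),
      map (fun f => f ≫ g) y ∈ opPow (μ X Z) (n + 1)) : AddIdeal (AugCat C) where
  carrier X Y := (opPow (μ X.obj Y.obj) (n + 1)).addSubgroupOf (augKer (X.obj ⟶ Y.obj))
  comp_left {X Y Z} f g hg := by
    change zcomp X.obj Y.obj Z.obj f.1 g.1 ∈ opPow (μ X.obj Z.obj) (n + 1)
    replace hg : g.1 ∈ opPow (μ Y.obj Z.obj) (n + 1) := hg
    generalize f.1 = x
    induction x using FreeAbelianGroup.induction_on with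
    | zero => simp
    | of f => rw [zcomp_of_left]; exact hl f _ hg
    | neg _ ih => rw [map_neg]; exact neg_mem ih
    | add _ _ h1 h2 => rw [map_add]; exact add_mem h1 h2
  comp_right {X Y Z} f g hf := by
    change zcomp X.obj Y.obj Z.obj f.1 g.1 ∈ opPow (μ X.obj Z.obj) (n + 1)
    replace hf : f.1 ∈ opPow (μ X.obj Y.obj) (n + 1) := hf
    generalize g.1 = x
    induction x using FreeAbelianGroup.induction_on with
    | zero => simp
    | of g => rw [zcomp_of_right]; exact hr g _ hf
    | neg _ ih => rw [map_neg]; exact neg_mem ih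
    | add _ _ h1 h2 => rw [map_add]; exact add_mem h1 h2

/-! ### Stability of the ideals under composition -/

/-- The pointwise monoid structure on `Hom(k, Y) ≅ Yᵏ`. -/
@[reducible] def monHomMonoid (X Y : FMon) : Monoid (X ⟶ Y) :=
  (FreeMonoid.lift (α := Fin X.rank) (M := FreeMonoid (Fin Y.rank))).symm.monoid

/-- The pointwise group structure on `Hom(k, Y) ≅ Yᵏ`. -/
@[reducible] def grpHomGroup (X Y : FGrp) : Group (X ⟶ Y) :=
  (FreeGroup.lift (α := Fin X.rank) (β := FreeGroup (Fin Y.rank))).symm.group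

attribute [local instance] monHomMonoid grpHomGroup

theorem FMon.mul_apply {X Y : FMon} (f g : X ⟶ Y) (i : Fin X.rank) :
    FMon.hom (f * g) (FreeMonoid.of i)
      = FMon.hom f (FreeMonoid.of i) * FMon.hom g (FreeMonoid.of i) :=
  FreeMonoid.lift_eval_of _ _

theorem FGrp.mul_apply {X Y : FGrp} (f g : X ⟶ Y) (i : Fin X.rank) :
    FGrp.hom (f * g) (FreeGroup.of i)
      = FGrp.hom f (FreeGroup.of i) * FGrp.hom g (FreeGroup.of i) :=
  FreeGroup.lift_apply_of

theorem FMon.one_apply {X Y : FMon} (i : Fin X.rank) :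
    FMon.hom (1 : X ⟶ Y) (FreeMonoid.of i) = 1 := FreeMonoid.lift_eval_of _ _

theorem FGrp.one_apply {X Y : FGrp} (i : Fin X.rank) :
    FGrp.hom (1 : X ⟶ Y) (FreeGroup.of i) = 1 := FreeGroup.lift_apply_of

/-- Evaluation at a letter is a homomorphism. -/
def FMon.evalHom (X Y : FMon) (i : Fin X.rank) : (X ⟶ Y) →* FreeMonoid (Fin Y.rank) where
  toFun f := FMon.hom f (FreeMonoid.of i)
  map_one' := FMon.one_apply i
  map_mul' f g := FMon.mul_apply f g i

/-- Evaluation at a letter is a homomorphism. -/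
def FGrp.evalHom (X Y : FGrp) (i : Fin X.rank) : (X ⟶ Y) →* FreeGroup (Fin Y.rank) where
  toFun f := FGrp.hom f (FreeGroup.of i)
  map_one' := FGrp.one_apply i
  map_mul' f g := FGrp.mul_apply f g i

theorem FMon.isFilt {M : Type*} [Monoid M] {X Y : FMon} {φ : M → (X ⟶ Y)}
    (h : ∀ i, IsFilt fun x => FMon.hom (φ x) (FreeMonoid.of i)) : IsFilt φ := by
  let e : (Fin X.rank → FreeMonoid (Fin Y.rank)) →* (X ⟶ Y) :=
    { toFun := fun v => FMon.mk' (FreeMonoid.lift v)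
      map_one' := FMon.hom_ext fun i =>
        (FreeMonoid.lift_eval_of _ _).trans (FMon.one_apply i).symm
      map_mul' := fun u v => FMon.hom_ext fun i => by
        rw [FMon.mul_apply]
        simp [FMon.hom, FMon.mk'] }
  have : φ = fun x => e fun i => FMon.hom (φ x) (FreeMonoid.of i) := by
    funext x
    exact FMon.hom_ext fun i => (FreeMonoid.lift_eval_of _ _).symm
  rw [this]
  exact (isFilt_hom e).comp (IsFilt.pi h)

theorem FGrp.isFilt {M : Type*} [Monoid M] {X Y : FGrp} {φ : M → (X ⟶ Y)}
    (h : ∀ i, IsFilt fun x => FGrp.hom (φ x) (FreeGroup.of i)) : IsFilt φ := by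
  let e : (Fin X.rank → FreeGroup (Fin Y.rank)) →* (X ⟶ Y) :=
    { toFun := fun v => FGrp.mk' (FreeGroup.lift v)
      map_one' := FGrp.hom_ext fun i =>
        FreeGroup.lift_apply_of.trans (FGrp.one_apply i).symm
      map_mul' := fun u v => FGrp.hom_ext fun i => by
        rw [FGrp.mul_apply]
        simp [FGrp.hom, FGrp.mk'] }
  have : φ = fun x => e fun i => FGrp.hom (φ x) (FreeGroup.of i) := by
    funext x
    exact FGrp.hom_ext fun i => FreeGroup.lift_apply_of.symm
  rw [this]
  exact (isFilt_hom e).comp (IsFilt.pi h)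

theorem isFilt_freeGroup_lift {M : Type*} [Monoid M] {α G : Type*} [Group G] {f : M → α → G}
    (h : ∀ i, IsFilt fun x => f x i) (w : FreeGroup α) :
    IsFilt fun x => FreeGroup.lift (f x) w := by
  induction w using FreeGroup.induction_on with
  | C1 => simpa using IsFilt.one
  | of i => simpa using h i
  | inv_of i hi => simpa using hi.inv
  | mul u v hu hv => simpa using hu.mul hv

theorem isFilt_freeMonoid_lift {M : Type*} [Monoid M] {α G : Type*} [Monoid G] {f : M → α → G}
    (h : ∀ i, IsFilt fun x => f x i) (w : FreeMonoid α) :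
    IsFilt fun x => FreeMonoid.lift (f x) w := by
  induction w using FreeMonoid.inductionOn with
  | one => simpa using IsFilt.one
  | of i => simpa using h i
  | mul u v hu hv => simpa using hu.mul hv

theorem mem_opPow_monOp (X Y : FMon) (n : ℕ) (y : FreeAbelianGroup (X ⟶ Y)) :
    y ∈ opPow (monOp X Y) (n + 1) ↔ y ∈ augIdeal (X ⟶ Y) ^ (n + 1) := by
  refine opPow_eq _ (fun m σ => FMon.isFilt fun i => ?_) (fun m => ⟨1, fun a => ?_⟩) n y
  · have : (fun f : Fin m → (X ⟶ Y) => FMon.hom (monOp X Y m σ f) (FreeMonoid.of i))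
        = fun f => (List.ofFn fun j => FMon.evalHom X Y i (f (σ j))).prod := by
      funext f; exact FreeMonoid.lift_eval_of _ _
    rw [this]
    exact IsFilt.listProd fun j =>
      isFilt_hom ((FMon.evalHom X Y i).comp (Pi.evalMonoidHom (fun _ => (X ⟶ Y)) (σ j)))
  · refine FMon.hom_ext fun i => ?_
    change _ = FMon.evalHom X Y i (List.ofFn a).prod
    rw [map_list_prod, List.map_ofFn]
    exact FreeMonoid.lift_eval_of _ _

theorem mem_opPow_grpOp (X Y : FGrp) (n : ℕ) (y : FreeAbelianGroup (X ⟶ Y)) :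
    y ∈ opPow (grpOp X Y) (n + 1) ↔ y ∈ augIdeal (X ⟶ Y) ^ (n + 1) := by
  refine opPow_eq _ (fun m w => FGrp.isFilt fun i => ?_)
    (fun m => ⟨(List.ofFn FreeGroup.of).prod, fun a => ?_⟩) n y
  · have : (fun f : Fin m → (X ⟶ Y) => FGrp.hom (grpOp X Y m w f) (FreeGroup.of i))
        = fun f => FreeGroup.lift (fun j => FGrp.evalHom X Y i (f j)) w := by
      funext f; exact FreeGroup.lift_apply_of
    rw [this]
    exact isFilt_freeGroup_lift (fun j =>
      isFilt_hom ((FGrp.evalHom X Y i).comp (Pi.evalMonoidHom (fun _ => (X ⟶ Y)) j))) w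
  · refine FGrp.hom_ext fun i => ?_
    change _ = FGrp.evalHom X Y i (List.ofFn a).prod
    rw [map_list_prod, List.map_ofFn]
    refine FreeGroup.lift_apply_of.trans ?_
    change FreeGroup.lift _ _ = _
    rw [map_list_prod, List.map_ofFn]
    congr 2
    funext j
    exact FreeGroup.lift_apply_of

theorem FMon.precomp_mem {X Y Z : FMon} (n : ℕ) (f : X ⟶ Y) (y : FreeAbelianGroup (Y ⟶ Z))
    (hy : y ∈ opPow (monOp Y Z) (n + 1)) :
    map (fun g => f ≫ g) y ∈ opPow (monOp X Z) (n + 1) := by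
  rw [mem_opPow_monOp] at *
  refine FMon.isFilt (φ := fun g : Y ⟶ Z => f ≫ g) (fun i => ?_) _ y hy
  have : (fun g : Y ⟶ Z => FMon.hom (f ≫ g) (FreeMonoid.of i))
      = fun g => FreeMonoid.lift (fun j => FMon.evalHom Y Z j g) (FMon.hom f (FreeMonoid.of i)) := by
    funext g
    exact DFunLike.congr_fun (FreeMonoid.lift_restrict (FMon.hom g)).symm _
  rw [this]
  exact isFilt_freeMonoid_lift (fun j => isFilt_hom (FMon.evalHom Y Z j)) _

theorem FMon.postcomp_mem {X Y Z : FMon} (n : ℕ) (g : Y ⟶ Z) (y : FreeAbelianGroup (X ⟶ Y))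
    (hy : y ∈ opPow (monOp X Y) (n + 1)) :
    map (fun f => f ≫ g) y ∈ opPow (monOp X Z) (n + 1) := by
  rw [mem_opPow_monOp] at *
  exact FMon.isFilt (φ := fun f : X ⟶ Y => f ≫ g)
    (fun i => isFilt_hom ((FMon.hom g).comp (FMon.evalHom X Y i))) _ y hy

theorem FGrp.precomp_mem {X Y Z : FGrp} (n : ℕ) (f : X ⟶ Y) (y : FreeAbelianGroup (Y ⟶ Z))
    (hy : y ∈ opPow (grpOp Y Z) (n + 1)) :
    map (fun g => f ≫ g) y ∈ opPow (grpOp X Z) (n + 1) := by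
  rw [mem_opPow_grpOp] at *
  refine FGrp.isFilt (φ := fun g : Y ⟶ Z => f ≫ g) (fun i => ?_) _ y hy
  have : (fun g : Y ⟶ Z => FGrp.hom (f ≫ g) (FreeGroup.of i))
      = fun g => FreeGroup.lift (fun j => FGrp.evalHom Y Z j g) (FGrp.hom f (FreeGroup.of i)) := by
    funext g
    exact DFunLike.congr_fun (FreeGroup.lift.apply_symm_apply (FGrp.hom g)).symm _
  rw [this]
  exact isFilt_freeGroup_lift (fun j => isFilt_hom (FGrp.evalHom Y Z j)) _

theorem FGrp.postcomp_mem {X Y Z : FGrp} (n : ℕ) (g : Y ⟶ Z) (y : FreeAbelianGroup (X ⟶ Y))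
    (hy : y ∈ opPow (grpOp X Y) (n + 1)) :
    map (fun f => f ≫ g) y ∈ opPow (grpOp X Z) (n + 1) := by
  rw [mem_opPow_grpOp] at *
  exact FGrp.isFilt (φ := fun f : X ⟶ Y => f ≫ g)
    (fun i => isFilt_hom ((FGrp.hom g).comp (FGrp.evalHom X Y i))) _ y hy

/-- The preadditive category `P_n^{As} mon`, with the objects of `mon`, morphism groups
`P_n^{As}(Hom(X, Y)) = I(Hom(X, Y)) / I_{As}^{n+1}(Hom(X, Y))`, and the composition such that
`p_n(g) ∘ p_n(f) = p_n(g ∘ f)`. -/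
abbrev PMon (n : ℕ) :=
  QuotCat (passiIdeal monOp n (fun f => FMon.precomp_mem n f) (fun g => FMon.postcomp_mem n g))

/-- The preadditive category `P_n^{Gr} gr`, with the objects of `gr`, morphism groups
`P_n^{Gr}(Hom(X, Y)) = I(Hom(X, Y)) / I_{Gr}^{n+1}(Hom(X, Y))`, and the composition such that
`p_n(g) ∘ p_n(f) = p_n(g ∘ f)`. -/
abbrev PGrp (n : ℕ) :=
  QuotCat (passiIdeal grpOp n (fun f => FGrp.precomp_mem n f) (fun g => FGrp.postcomp_mem n g))

/-- The functor `mon → P_n^{As} mon`, the identity on objects and `f ↦ p_n(f)`, the class of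
`f - 0`, on morphisms. -/
def pMon (n : ℕ) : FMon ⥤ PMon n := augFunctor FMon ⋙ QuotCat.proj _

/-- The functor `gr → P_n^{Gr} gr`, the identity on objects and `f ↦ p_n(f)`, the class of
`f - 0`, on morphisms. -/
def pGrp (n : ℕ) : FGrp ⥤ PGrp n := augFunctor FGrp ⋙ QuotCat.proj _

end Passi

/-- `F` is an isomorphism of preadditive categories: an additive functor with a strict inverse. -/
def IsPreaddIso {C D : Type*} [Category C] [Category D] [Preadditive C] [Preadditive D]
    (F : C ⥤ D) : Prop :=
  F.Additive ∧ ∃ G : D ⥤ C, F ⋙ G = 𝟭 C ∧ G ⋙ F = 𝟭 D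
end PolyFun

open PolyFun

open PolyFun

namespace PolyFun

/-! ## Group rings of groupifications modulo powers of the augmentation ideal -/

section Groupification

universe u v

open FreeAbelianGroup

variable {M : Type u} {G : Type v} [Monoid M] [Group G]

/-! Give `Hom(k, l)` its pointwise structure. By `mem_opPow_monOp` and `mem_opPow_grpOp`, both
operadic ideals are then the ordinary power `I^{n+1}` of the augmentation ideal, so the theorem
becomes a statement about monoid rings modulo powers of `I`.

The main point is that a groupification `ι : M → G` induces `ℤ[M]/I(M)^n ≅ ℤ[G]/I(G)^n`. Modulo
`I(M)^n` the element `1 - m` is nilpotent, so `m` is already invertible there, and the universal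
property of `G` yields a ring map `ℤ[G] → ℤ[M]/I(M)^n` that kills `I(G)^n`. This gives injectivity
(`IsGroupification.map_mem_pow_iff`). Surjectivity holds because truncated geometric series
approximate the inverses (`IsGroupification.exists_map_sub_mem`). The result applies to `Hom_mon(k,
l) → Hom_gr(k, l)`, which is a finite power of the map from a free monoid to the free group and is
again a groupification (`isGroupification_etaPi`). Part 1 follows.

For part 2, both categories satisfy `IsPointwise`, and this alone identifies the image of the
`(n+1)`-st cross-effect of `U_X` in `ℤ[Hom(X, Y)]/ℤ·0` with `I^{n+1}`
(`IsPointwise.mk_mem_taylorKer_iff`). In one direction the folding map is traded for a product of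
`n+1` differences `π_i - 1` (`map_fold_mem`). In the other, the `i`-th factor of a product is placed
in the `i`-th summand (`exists_map_fold_eq`). This gives `Φ` and `Ψ`, and `T_n g` is `P_n g`
conjugated by them. -/

theorem one_sub_of_pow_mem (m : M) (n : ℕ) : (1 - of m) ^ n ∈ augIdeal M ^ n := by
  have h : (1 : FreeAbelianGroup M) - of m ∈ augIdeal M := by
    rw [← neg_sub]; exact neg_mem (of_sub_one_mem m)
  induction n with
  | zero => exact mem_pow_zero
  | succ n ih =>
    rw [_root_.pow_succ', Ideal.IsTwoSided.pow_succ]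
    exact Ideal.mul_mem_mul h ih

/-- Here `m = 1 - (1 - m)`, and `1 - m` is nilpotent modulo `I^n`. Monoid elements are thus inverted
before any passage to the group. -/
theorem isUnit_mk_of (m : M) (n : ℕ) :
    IsUnit (Ideal.Quotient.mk (augIdeal M ^ n) (of m)) := by
  have h : IsNilpotent (Ideal.Quotient.mk (augIdeal M ^ n) (1 - of m)) :=
    ⟨n, by rw [← map_pow]; exact Ideal.Quotient.eq_zero_iff_mem.2 (one_sub_of_pow_mem m n)⟩
  have h' := h.isUnit_one_sub
  rwa [map_sub, map_one, sub_sub_cancel] at h'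

/-- The homomorphism from `M` to the units of `ℤ[M] / I(M)^n`. -/
noncomputable def toQuotUnits (M : Type u) [Monoid M] (n : ℕ) :
    M →* (FreeAbelianGroup M ⧸ augIdeal M ^ n)ˣ :=
  IsUnit.liftRight ((Ideal.Quotient.mk (augIdeal M ^ n) : _ →* _).comp ofMulHom)
    fun m => isUnit_mk_of m n

theorem coe_toQuotUnits (n : ℕ) (m : M) :
    ((toQuotUnits M n m : (FreeAbelianGroup M ⧸ augIdeal M ^ n)ˣ) :
      FreeAbelianGroup M ⧸ augIdeal M ^ n) = Ideal.Quotient.mk _ (of m) :=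
  IsUnit.coe_liftRight _ _ _

/-- A homomorphism from a monoid to a group through which all homomorphisms to groups factor, and
whose image generates the group. -/
structure IsGroupification (ι : M →* G) : Prop where
  closure_range : Subgroup.closure (Set.range ι) = ⊤
  exists_extension : ∀ {H : Type u} [Group H] (φ : M →* H), ∃ ψ : G →* H, ψ.comp ι = φ

variable {ι : M →* G}

/-- This is surjectivity of `ℤ[M] → ℤ[G]/I(G)^n`. The image is a subring, so it suffices to reach
the elements `ι m` and their inverses, which generate `G`. -/
theorem IsGroupification.exists_map_sub_mem (hι : IsGroupification ι) (n : ℕ)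
    (y : FreeAbelianGroup G) : ∃ x, map ι x - y ∈ augIdeal G ^ n := by
  induction y using FreeAbelianGroup.induction_on with
  | zero => exact ⟨0, by simp⟩
  | neg _ ih =>
    obtain ⟨x, hx⟩ := ih
    refine ⟨-x, ?_⟩
    rw [map_neg, ← neg_sub']; exact neg_mem hx
  | add _ _ h1 h2 =>
    obtain ⟨x, hx⟩ := h1
    obtain ⟨x', hx'⟩ := h2
    refine ⟨x + x', ?_⟩
    rw [map_add, add_sub_add_comm]; exact add_mem hx hx'
  | of g =>
    have hg : g ∈ Subgroup.closure (Set.range ι) := by rw [hι.closure_range]; trivial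
    induction hg using Subgroup.closure_induction'' with
    | mem g hg =>
      obtain ⟨m, rfl⟩ := hg
      exact ⟨of m, by simp⟩
    | inv_mem g hg =>
      obtain ⟨m, rfl⟩ := hg
      -- With `u = 1 - ι m`, the inverse of `ι m` is formally `∑ u^i`. Cutting the series at `n`
      -- leaves the error `-u^n (ι m)⁻¹`, which lies in `I(G)^n`.
      refine ⟨∑ i ∈ Finset.range n, (1 - of m) ^ i, ?_⟩
      let f := liftMonoid (ofMulHom.comp ι)
      have hf : ∀ z, map ι z = f z := fun z => rfl
      have h1 : f (of m) = of (ι m) := by rw [← hf, map_of_apply]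
      have h := geom_sum_mul (1 - of (ι m)) n
      have h2 : (1 : FreeAbelianGroup G) - of (ι m) - 1 = - of (ι m) := by abel
      rw [h2] at h
      rw [hf, map_sum]
      simp only [map_pow, map_sub, map_one, h1]
      have e : ∑ i ∈ Finset.range n, (1 - of (ι m)) ^ i - of (ι m)⁻¹
          = -((1 - of (ι m)) ^ n * of (ι m)⁻¹) := by
        have h3 : of (ι m) * of (ι m)⁻¹ = (1 : FreeAbelianGroup G) := by
          rw [← FreeAbelianGroup.of_mul, mul_inv_cancel, FreeAbelianGroup.one_def]
        rw [eq_add_of_sub_eq h.symm, add_mul, mul_neg, neg_mul, mul_assoc, h3, mul_one, one_mul]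
        abel
      rw [e]
      exact neg_mem (Ideal.mul_mem_right _ _ (one_sub_of_pow_mem _ n))
    | one => exact ⟨of 1, by simp⟩
    | mul g g' _ _ h1 h2 =>
      obtain ⟨x, hx⟩ := h1
      obtain ⟨x', hx'⟩ := h2
      refine ⟨x * x', ?_⟩
      have e : map ι (x * x') - of (g * g')
          = (map ι x - of g) * map ι x' + of g * (map ι x' - of g') := by
        rw [map_mul_of_hom, FreeAbelianGroup.of_mul]; noncomm_ring
      rw [e]
      exact add_mem (Ideal.mul_mem_right _ _ hx) (Ideal.mul_mem_left _ _ hx')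

/-- The exponent `n + 1` is positive, so the error has augmentation zero. As `map ι` preserves
augmentations, any approximate preimage of `y` lies in `I(M)` automatically. -/
theorem IsGroupification.exists_mem_augKer (hι : IsGroupification ι) (n : ℕ)
    {y : FreeAbelianGroup G} (hy : y ∈ augKer G) :
    ∃ x ∈ augKer M, map ι x - y ∈ augIdeal G ^ (n + 1) := by
  obtain ⟨x, hx⟩ := hι.exists_map_sub_mem (n + 1) y
  have h := Ideal.pow_le_self (Nat.succ_ne_zero n) hx
  rw [mem_augIdeal, map_sub, aug_map, sub_eq_zero] at h
  exact ⟨x, h.trans hy, hx⟩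

/-- If `ψ` extends `m ↦ [m]` to `G`, then `ψ g - 1` comes from the augmentation ideal. -/
theorem IsGroupification.exists_mem_augIdeal_mk_eq (hι : IsGroupification ι) {n : ℕ}
    {ψ : G →* (FreeAbelianGroup M ⧸ augIdeal M ^ n)ˣ} (hψ : ψ.comp ι = toQuotUnits M n) (g : G) :
    ∃ x ∈ augIdeal M, Ideal.Quotient.mk (augIdeal M ^ n) x = ψ g - 1 := by
  have hg : g ∈ Subgroup.closure (Set.range ι) := by rw [hι.closure_range]; trivial
  induction hg using Subgroup.closure_induction with
  | mem g hg =>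
    obtain ⟨m, rfl⟩ := hg
    refine ⟨of m - 1, of_sub_one_mem m, ?_⟩
    rw [← MonoidHom.comp_apply, hψ, coe_toQuotUnits, map_sub, map_one]
  | one => exact ⟨0, zero_mem _, by simp⟩
  | mul g g' _ _ h1 h2 =>
    obtain ⟨x, hx, e⟩ := h1
    obtain ⟨x', hx', e'⟩ := h2
    -- The identity used is `ψ(gg') - 1 = ψ(g)(ψ(g') - 1) + (ψ(g) - 1)`, with `z` lifting `ψ(g)`.
    -- Inverses use `ψ(g⁻¹) - 1 = -ψ(g⁻¹)(ψ(g) - 1)` in the same way.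
    obtain ⟨z, hz⟩ := Ideal.Quotient.mk_surjective (ψ g : FreeAbelianGroup M ⧸ augIdeal M ^ n)
    refine ⟨z * x' + x, add_mem (Ideal.mul_mem_left _ _ hx') hx, ?_⟩
    rw [map_add, RingHom.map_mul, hz, e, e', map_mul, Units.val_mul, mul_sub, mul_one]
    abel
  | inv g _ h =>
    obtain ⟨x, hx, e⟩ := h
    obtain ⟨z, hz⟩ := Ideal.Quotient.mk_surjective (ψ g⁻¹ : FreeAbelianGroup M ⧸ augIdeal M ^ n)
    refine ⟨-(z * x), neg_mem (Ideal.mul_mem_left _ _ hx), ?_⟩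
    rw [map_neg, RingHom.map_mul, hz, e, mul_sub, ← Units.val_mul, ← map_mul, inv_mul_cancel]
    simp

/-- This is injectivity of `ℤ[M]/I(M)^n → ℤ[G]/I(G)^n`. The extension of `m ↦ [m]` to `G` gives `ρ :
ℤ[G] → ℤ[M]/I(M)^n` whose composite with `map ι` is the quotient map, so it is enough that `ρ`
vanishes on `I(G)^n`. The universal property is needed only for the units of `ℤ[M]/I(M)^n`, which
live in the universe of `M`. -/
theorem IsGroupification.map_mem_pow_iff (hι : IsGroupification ι) (n : ℕ)
    (x : FreeAbelianGroup M) : map ι x ∈ augIdeal G ^ n ↔ x ∈ augIdeal M ^ n := by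
  refine ⟨fun h => ?_, isFilt_hom ι n x⟩
  obtain ⟨ψ, hψ⟩ := hι.exists_extension (toQuotUnits M n)
  let ρ : FreeAbelianGroup G →+* FreeAbelianGroup M ⧸ augIdeal M ^ n :=
    liftMonoid ((Units.coeHom _).comp ψ)
  have hρ : ∀ g, ρ (of g) = ψ g := fun g => lift_apply_of _ g
  have hmap : ∀ x, ρ (map ι x) = Ideal.Quotient.mk _ x := fun x => by
    have : ρ.toAddMonoidHom.comp (map ι) = (Ideal.Quotient.mk (augIdeal M ^ n)).toAddMonoidHom := by
      refine FreeAbelianGroup.lift_ext _ _ fun m => ?_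
      change ρ (map ι (of m)) = Ideal.Quotient.mk _ (of m)
      rw [map_of_apply, hρ, ← MonoidHom.comp_apply, hψ, coe_toQuotUnits]
    exact DFunLike.congr_fun this x
  -- The exponent `t` varies while the modulus `n` stays fixed. At `t = n` the representative `z` is
  -- itself zero in the quotient.
  have key : ∀ t, ∀ y ∈ augIdeal G ^ t, ∃ z ∈ augIdeal M ^ t, Ideal.Quotient.mk _ z = ρ y := by
    intro t
    induction t with
    | zero => exact fun y _ => (Ideal.Quotient.mk_surjective (ρ y)).imp fun z hz =>
        ⟨mem_pow_zero, hz⟩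
    | succ t ih =>
      intro y hy
      refine pow_succ_induction ((((Submodule.toAddSubgroup (augIdeal M ^ (t + 1))).map
        (Ideal.Quotient.mk (augIdeal M ^ n)).toAddMonoidHom)).comap ρ.toAddMonoidHom) (fun g w hw => ?_) hy
      obtain ⟨z, hz, e⟩ := ih w hw
      obtain ⟨a, ha, e'⟩ := hι.exists_mem_augIdeal_mk_eq hψ g
      refine ⟨a * z, ?_, ?_⟩
      · change a * z ∈ augIdeal M ^ (t + 1)
        rw [Ideal.IsTwoSided.pow_succ]; exact Ideal.mul_mem_mul ha hz
      · change Ideal.Quotient.mk _ (a * z) = ρ ((of g - 1) * w)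
        rw [RingHom.map_mul, RingHom.map_mul, e, e', map_sub, map_one, hρ]
  obtain ⟨z, hz, e⟩ := key n _ h
  rw [← Ideal.Quotient.eq_zero_iff_mem, ← hmap, ← e]
  exact Ideal.Quotient.eq_zero_iff_mem.2 hz

/-! ### Powers of free monoids -/

theorem etaFree_of {α : Type*} (a : α) : etaFree α (FreeMonoid.of a) = FreeGroup.of a :=
  FreeMonoid.lift_eval_of _ _

theorem closure_range_etaFree (α : Type*) : Subgroup.closure (Set.range (etaFree α)) = ⊤ := by
  rw [eq_top_iff, ← FreeGroup.closure_range_of, Subgroup.closure_le]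
  rintro _ ⟨a, rfl⟩
  exact Subgroup.subset_closure ⟨FreeMonoid.of a, etaFree_of a⟩

/-- The canonical map from a power of a free monoid to the power of the free group. -/
def etaPi (k : Type*) (α : Type*) : (k → FreeMonoid α) →* (k → FreeGroup α) where
  toFun v i := etaFree α (v i)
  map_one' := by funext; simp
  map_mul' u v := by funext; simp

theorem commute_freeGroup_lift {α H : Type*} [Group H] {f g : α → H}
    (h : ∀ a b, Commute (f a) (g b)) (x y : FreeGroup α) :
    Commute (FreeGroup.lift f x) (FreeGroup.lift g y) := by
  induction x using FreeGroup.induction_on with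
  | C1 => simp
  | inv_of a ha => simpa using Commute.inv_left ha
  | mul u v hu hv => simpa using Commute.mul_left hu hv
  | of a =>
    induction y using FreeGroup.induction_on with
    | C1 => simp
    | inv_of a ha => simpa using Commute.inv_right ha
    | mul u v hu hv => simpa using Commute.mul_right hu hv
    | of b => simpa using h a b

/-- A homomorphism out of a finite product is a family of homomorphisms with pairwise commuting
images. Commutation of the images of the letters passes to all words in them and their inverses, so
the extensions of the components to the free groups still commute and assemble to
`MonoidHom.noncommPiCoprod`. -/
theorem isGroupification_etaPi (k : Type*) (α : Type*) [Finite k] :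
    IsGroupification (etaPi k α) where
  closure_range := by
    -- The product of the closures is the closure of the product because each of the sets contains
    -- `1`.
    have h := Subgroup.closure_pi (η := k) (f := fun _ => FreeGroup α)
      (s := fun _ => Set.range (etaFree α)) fun _ => ⟨1, map_one _⟩
    rw [closure_range_etaFree, Subgroup.pi_top] at h
    rw [← h]
    congr 1
    ext v
    constructor
    · rintro ⟨u, rfl⟩ i _
      exact ⟨u i, rfl⟩
    · intro hv
      choose u hu using fun i => hv i trivial
      exact ⟨u, funext hu⟩
  exists_extension {H} _ φ := by
    classical
    cases nonempty_fintype k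
    let ψ : k → FreeGroup α →* H := fun i =>
      FreeGroup.lift fun a => φ (Pi.mulSingle i (FreeMonoid.of a))
    have hc : Pairwise fun i j => ∀ x y, Commute (ψ i x) (ψ j y) := fun i j hij =>
      commute_freeGroup_lift fun a b => (Pi.mulSingle_commute hij _ _).map φ
    refine ⟨MonoidHom.noncommPiCoprod ψ hc, MonoidHom.pi_ext fun i x => ?_⟩
    have e : etaPi k α (Pi.mulSingle i x) = Pi.mulSingle i (etaFree α x) := by
      funext j
      exact Pi.apply_mulSingle (fun _ => etaFree α) (fun _ => map_one _) i x j
    rw [MonoidHom.comp_apply, e, MonoidHom.noncommPiCoprod_mulSingle]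
    have : (ψ i).comp (etaFree α) = φ.comp (MonoidHom.mulSingle (fun _ => FreeMonoid α) i) :=
      FreeMonoid.hom_eq fun a => by simp [etaFree_of, ψ]
    exact DFunLike.congr_fun this x

theorem IsGroupification.of_mulEquiv (hι : IsGroupification ι) {M' : Type u} {G' : Type*}
    [Monoid M'] [Group G'] (e : M' ≃* M) (e' : G' ≃* G) {ι' : M' →* G'}
    (h : ∀ m, e' (ι' m) = ι (e m)) : IsGroupification ι' where
  closure_range := by
    have hr : (e' : G' →* G) '' Set.range ι' = Set.range ι := by
      ext g
      constructor
      · rintro ⟨_, ⟨m, rfl⟩, rfl⟩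
        exact ⟨e m, (h m).symm⟩
      · rintro ⟨m, rfl⟩
        exact ⟨_, ⟨e.symm m, rfl⟩, (h _).trans (by simp)⟩
    refine Subgroup.map_injective (f := (e' : G' →* G)) e'.injective ?_
    rw [MonoidHom.map_closure, hr, hι.closure_range,
      Subgroup.map_top_of_surjective _ e'.surjective]
  exists_extension φ := by
    obtain ⟨ψ, hψ⟩ := hι.exists_extension (φ.comp (e.symm : M →* M'))
    refine ⟨ψ.comp (e' : G' →* G), MonoidHom.ext fun m => ?_⟩
    have := DFunLike.congr_fun hψ (e m)
    simpa [h] using this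

end Groupification

/-! ### Groupification on morphism sets -/

section HomGroupification

open FreeAbelianGroup

attribute [local instance] monHomMonoid grpHomGroup

/-- Groupification, as a homomorphism for the pointwise structures. -/
def groupificationHom (X Y : FMon) :
    (X ⟶ Y) →* (groupification.obj X ⟶ groupification.obj Y) where
  toFun f := groupification.map f
  map_one' := FGrp.hom_ext fun (i : Fin X.rank) =>
    FreeGroup.lift_apply_of.trans <|
      (congrArg (etaFree _) (FMon.one_apply i)).trans <| (map_one (etaFree _)).trans
      (FGrp.one_apply (X := groupification.obj X) (Y := groupification.obj Y) i).symm
  map_mul' f g := FGrp.hom_ext fun (i : Fin X.rank) =>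
    FreeGroup.lift_apply_of.trans <|
      (congrArg (etaFree _) (FMon.mul_apply f g i)).trans <| (map_mul (etaFree _) _ _).trans <|
      (congrArg₂ (· * ·) FreeGroup.lift_apply_of.symm FreeGroup.lift_apply_of.symm).trans
      (FGrp.mul_apply (groupification.map f) (groupification.map g) i).symm

/-- Evaluation at the letters identifies this map with the `k`-th power of `etaFree`, where `k` is
the rank of `X`. -/
theorem isGroupification_groupificationHom (X Y : FMon) :
    IsGroupification (groupificationHom X Y) :=
  (isGroupification_etaPi (Fin X.rank) (Fin Y.rank)).of_mulEquiv
    (FreeMonoid.lift (α := Fin X.rank) (M := FreeMonoid (Fin Y.rank))).symm.mulEquiv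
    (FreeGroup.lift (α := Fin X.rank) (β := FreeGroup (Fin Y.rank))).symm.mulEquiv
    fun _ => funext fun _ => FreeGroup.lift_apply_of

end HomGroupification

/-! ## Isomorphisms of preadditive categories -/

section PreaddIso

variable {C D E : Type*} [Category C] [Category D] [Category E] [Preadditive C] [Preadditive D]
  [Preadditive E]

theorem isPreaddIso_of_full_of_faithful (F : C ⥤ D) [F.Additive] [F.Full] [F.Faithful] (s : D → C)
    (h₁ : ∀ X, s (F.obj X) = X) (h₂ : ∀ Y, F.obj (s Y) = Y) : IsPreaddIso F := by
  refine ⟨inferInstance, ⟨{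
    obj := s
    -- The composite of `s` and `F` is the identity on objects only up to a propositional equality,
    -- so `f` is conjugated by the resulting `eqToHom`s.
    map := fun {X Y} f => F.preimage (eqToHom (h₂ X) ≫ f ≫ eqToHom (h₂ Y).symm)
    map_id := fun X => F.map_injective (by simp)
    map_comp := fun f g => F.map_injective (by simp) }, ?_, ?_⟩⟩
  · exact CategoryTheory.Functor.ext h₁ fun X Y f => F.map_injective (by simp [eqToHom_map])
  · exact CategoryTheory.Functor.ext h₂ fun X Y f => by simp

theorem IsPreaddIso.comp {F : C ⥤ D} {G : D ⥤ E} (hF : IsPreaddIso F) (hG : IsPreaddIso G) :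
    IsPreaddIso (F ⋙ G) := by
  obtain ⟨_, F', h₁, h₂⟩ := hF
  obtain ⟨_, G', h₃, h₄⟩ := hG
  refine ⟨inferInstance, G' ⋙ F', ?_, ?_⟩
  · rw [Functor.assoc, ← Functor.assoc G, h₃, Functor.id_comp, h₁]
  · rw [Functor.assoc, ← Functor.assoc F', h₂, Functor.id_comp, h₄]

/-- Only the additivity of `G` is missing. The functor `F` is additive and faithful, so it can be
checked after applying `F`, where `G ⋙ F = 𝟭 D` makes it evident. -/
theorem IsPreaddIso.exists_inverse {F : C ⥤ D} (hF : IsPreaddIso F) :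
    ∃ G : D ⥤ C, IsPreaddIso G ∧ F ⋙ G = 𝟭 C ∧ G ⋙ F = 𝟭 D := by
  obtain ⟨_, G, h₁, h₂⟩ := hF
  refine ⟨G, ⟨⟨fun {X Y f g} => ?_⟩, F, h₂, h₁⟩, h₁, h₂⟩
  -- By `F ⋙ G = 𝟭 C`, applying `G` to `F.map a` returns `a` up to composition with `eqToHom`s,
  -- which cancel.
  have hinj : Function.Injective fun h : G.obj X ⟶ G.obj Y => F.map h := fun a b hab => by
    have ha := Functor.congr_hom h₁ a
    have hb := Functor.congr_hom h₁ b
    simp only [Functor.comp_map, Functor.id_map] at ha hb hab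
    rw [hab, hb] at ha
    exact (cancel_mono _).1 ((cancel_epi _).1 ha.symm)
  refine hinj ?_
  have e := fun k : X ⟶ Y => Functor.congr_hom h₂ k
  simp only [Functor.comp_map, Functor.id_map] at e
  simp only [Functor.map_add, e, Preadditive.add_comp, Preadditive.comp_add]

end PreaddIso

/-! ## Functors between quotient categories -/

namespace QuotCat

universe v u v' u'

variable {D : Type u} [Category.{v} D] [Preadditive D] {K : AddIdeal D}

instance proj_additive : (proj K).Additive where
  map_add := rfl

theorem map_proj_surjective {X Y : QuotCat K} (f : X ⟶ Y) :
    ∃ g : X.obj ⟶ Y.obj, (proj K).map g = f := QuotientAddGroup.mk_surjective f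

theorem map_proj_eq_zero_iff {X Y : D} (f : X ⟶ Y) :
    (proj K).map f = 0 ↔ f ∈ K.carrier X Y := QuotientAddGroup.eq_zero_iff f

/-- Functors on a quotient category are determined by their restrictions. -/
theorem functor_ext {E' : Type*} [Category E'] {Q Q' : QuotCat K ⥤ E'}
    (h : proj K ⋙ Q = proj K ⋙ Q') : Q = Q' := by
  refine CategoryTheory.Functor.ext (fun X => Functor.congr_obj h X.obj) fun X Y f => ?_
  obtain ⟨f, rfl⟩ := map_proj_surjective f
  exact Functor.congr_hom h f

variable {E : Type u'} [Category.{v'} E] [Preadditive E]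

/-- The functor out of a quotient category induced by an additive functor which vanishes on the
ideal. -/
def lift (F : D ⥤ E) [F.Additive]
    (h : ∀ {X Y : D} (f : X ⟶ Y), f ∈ K.carrier X Y → F.map f = 0) : QuotCat K ⥤ E where
  obj X := F.obj X.obj
  map {X Y} := QuotientAddGroup.lift _ (F.mapAddHom (X := X.obj) (Y := Y.obj)) fun f => h f
  map_id X := F.map_id X.obj
  map_comp {X Y Z} f g := by
    obtain ⟨f, rfl⟩ := map_proj_surjective f
    obtain ⟨g, rfl⟩ := map_proj_surjective g
    exact F.map_comp f g

section Lift

variable (F : D ⥤ E) [F.Additive]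
  (h : ∀ {X Y : D} (f : X ⟶ Y), f ∈ K.carrier X Y → F.map f = 0)

instance lift_additive : (lift F h).Additive where
  map_add {X Y f g} := map_add (QuotientAddGroup.lift (K.carrier X.obj Y.obj)
    (F.mapAddHom (X := X.obj) (Y := Y.obj)) fun f => h f) f g

end Lift

/-- An additive functor which is bijective on objects, full modulo an ideal, and under which one
ideal is the inverse image of another one, induces an isomorphism of the quotient categories. -/
theorem isPreaddIso_lift (F : D ⥤ E) [F.Additive]
    (h : ∀ {X Y : D} (f : X ⟶ Y), F.map f = 0 ↔ f ∈ K.carrier X Y)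
    (hF : ∀ {X Y : D} (g : F.obj X ⟶ F.obj Y), ∃ f, F.map f = g) (s : E → D)
    (h₁ : ∀ X, s (F.obj X) = X) (h₂ : ∀ Y, F.obj (s Y) = Y) :
    IsPreaddIso (lift F fun f => (h f).2) := by
  have : (lift F fun f => (h f).2).Full := ⟨fun {X Y} g => by
    obtain ⟨f, hf⟩ := hF (X := X.obj) (Y := Y.obj) g
    exact ⟨(proj K).map f, hf⟩⟩
  have : (lift F fun f => (h f).2).Faithful := ⟨fun {X Y f g} hfg => by
    obtain ⟨f, rfl⟩ := map_proj_surjective f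
    obtain ⟨g, rfl⟩ := map_proj_surjective g
    change F.map f = F.map g at hfg
    change (proj K).map f = (proj K).map g
    rw [← sub_eq_zero, ← F.map_sub, h, ← map_proj_eq_zero_iff,
      Functor.map_sub, sub_eq_zero] at hfg
    exact hfg⟩
  exact isPreaddIso_of_full_of_faithful _ (fun Y => (proj K).obj (s Y))
    (fun X => congrArg (proj K).obj (h₁ X.obj)) h₂

end QuotCat

/-! ## Functors on the augmentation category -/

section Generic

universe v u v' u'

open FreeAbelianGroup

variable {C : Type u} [Category.{v} C] [HasZeroMorphisms C]

theorem aug_sub_smul_mem (A : Type*) (a : A) (x : FreeAbelianGroup A) :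
    x - aug A x • of a ∈ augKer A := by
  simp [mem_augKer]

/-- The functor `ℤ[C] → AugCat C`, `x ↦ x - ε(x) 0`. -/
def zcatToAug (C : Type u) [Category.{v} C] [HasZeroMorphisms C] : ZCat C ⥤ AugCat C where
  obj X := ⟨X.obj⟩
  map {X Y} (x : FreeAbelianGroup (X.obj ⟶ Y.obj)) := ⟨x - aug _ x • of 0, aug_sub_smul_mem _ _ x⟩
  map_id X := Subtype.ext <| by
    change of (𝟙 X.obj) - aug _ (of (𝟙 X.obj)) • of 0 = of (𝟙 X.obj) - of 0
    simp
  map_comp {X Y Z} x y := Subtype.ext <| by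
    change zcomp X.obj Y.obj Z.obj x y - aug _ (zcomp X.obj Y.obj Z.obj x y) • of 0
      = zcomp X.obj Y.obj Z.obj (x - aug _ x • of 0) (y - aug _ y • of 0)
    rw [aug_zcomp]
    simp only [map_sub, map_zsmul, AddMonoidHom.sub_apply, AddMonoidHom.smul_apply,
      zcomp_zero_right, zcomp_zero_left, aug_of, smul_smul, one_smul, sub_self, smul_zero,
      sub_zero]

instance : (zcatToAug C).Additive where
  map_add {X Y} (x y : FreeAbelianGroup (X.obj ⟶ Y.obj)) := Subtype.ext <| by
    change x + y - aug _ (x + y) • of 0 = (x - aug _ x • of 0) + (y - aug _ y • of 0)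
    rw [map_add, add_smul]; abel

/-- Together with `zcatToAug_map_val`, this says that `x ↦ x - ε(x) 0` splits `ℤ[Hom]` as `I ⊕ ℤ·0`.
Hence `U_X(Y)` and `I(Hom(X, Y))` are the same group, and `ℤ̄[C]` can be compared with `AugCat C`.
-/
theorem zcatToAug_map_eq_zero_iff {X Y : ZCat C} (x : X ⟶ Y) :
    (zcatToAug C).map x = 0 ↔ x ∈ (zeroIdeal C).carrier X Y := by
  refine (Subtype.ext_iff (p := fun x => x ∈ augKer (X.obj ⟶ Y.obj))).trans ?_
  change (x : FreeAbelianGroup (X.obj ⟶ Y.obj)) - aug _ x • of 0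
    = (0 : FreeAbelianGroup (X.obj ⟶ Y.obj)) ↔ _ ∈ AddSubgroup.zmultiples _
  rw [sub_eq_zero, AddSubgroup.mem_zmultiples_iff]
  refine ⟨fun h => ⟨_, h.symm⟩, ?_⟩
  rintro ⟨k, hk⟩
  rw [← hk]; simp

theorem zcatToAug_map_val {X Y : ZCat C} (x : augKer (X.obj ⟶ Y.obj)) :
    (zcatToAug C).map (X := X) (Y := Y) x.1 = x := Subtype.ext <| by
  change x.1 - aug _ x.1 • of 0 = x.1
  rw [mem_augKer.1 x.2]; simp

theorem zcatToAug_map_of {X Y : C} (f : X ⟶ Y) :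
    (zcatToAug C).map (X := ⟨X⟩) (Y := ⟨Y⟩) (of f : FreeAbelianGroup (X ⟶ Y))
      = (augFunctor C).map f := Subtype.ext <| by
  change of f - aug _ (of f) • of 0 = (of f - of 0 : FreeAbelianGroup (X ⟶ Y))
  simp

/-- The functor `ℤ̄[C] → AugCat C` sending the class of `x` to `x - ε(x) 0`. -/
def zredToAug (C : Type u) [Category.{v} C] [HasZeroMorphisms C] : ZRed C ⥤ AugCat C :=
  QuotCat.lift (zcatToAug C) fun x => (zcatToAug_map_eq_zero_iff x).2

instance : (zredToAug C).Additive := QuotCat.lift_additive _ fun x => (zcatToAug_map_eq_zero_iff x).2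

theorem zredFunctor_comp_zredToAug : zredFunctor C ⋙ zredToAug C = augFunctor C := by
  refine Functor.hext (fun _ => rfl) fun X Y f => heq_of_eq (zcatToAug_map_of f)

/-- Additive functors on the augmentation category are determined by their restrictions. -/
theorem AugCat.functor_ext {E : Type u'} [Category.{v'} E] [Preadditive E] {Q Q' : AugCat C ⥤ E}
    [Q.Additive] [Q'.Additive] (h : augFunctor C ⋙ Q = augFunctor C ⋙ Q') : Q = Q' := by
  have ho : ∀ X, Q.obj X = Q'.obj X := fun X => Functor.congr_obj h X.obj
  refine CategoryTheory.Functor.ext ho fun X Y f => ?_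
  -- Writing `f` as the image of an element of `ℤ[Hom]` permits induction over basis elements, which
  -- do not lie in `I(Hom)` themselves.
  obtain ⟨x, rfl⟩ : ∃ x, (zcatToAug C).map (X := ⟨X.obj⟩) (Y := ⟨Y.obj⟩) x = f :=
    ⟨f.1, zcatToAug_map_val (X := ⟨X.obj⟩) (Y := ⟨Y.obj⟩) f⟩
  let a : FreeAbelianGroup (X.obj ⟶ Y.obj) →+ (X ⟶ Y) :=
    (zcatToAug C).mapAddHom (X := ⟨X.obj⟩) (Y := ⟨Y.obj⟩)
  have ha : ∀ f, a (of f) = (augFunctor C).map f := zcatToAug_map_of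
  change Q.map (a x) = eqToHom (ho X) ≫ Q'.map (a x) ≫ eqToHom (ho Y).symm
  induction x using FreeAbelianGroup.induction_on with
  | zero => simp
  | of f => rw [ha]; exact Functor.congr_hom h f
  | neg _ ih => simp [ih]
  | add _ _ h1 h2 => simp [h1, h2]

end Generic

/-! ## Taylorisation of the universal functors and powers of the augmentation ideal -/

section Taylor

universe v u

open FreeAbelianGroup

variable {C : Type u} [Category.{v} C] [HasZeroMorphisms C]

/-- Monoid structures on the morphism sets of `C`, natural in the target, with the zero morphisms as
units, compatible with the augmentation filtration in the source, and such that each object has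
copowers whose inclusions induce homomorphisms. -/
structure IsPointwise (C : Type u) [Category.{v} C] [HasZeroMorphisms C]
    [∀ X Y : C, Monoid (X ⟶ Y)] : Prop where
  one_eq_zero : ∀ X Y : C, (1 : X ⟶ Y) = 0
  mul_comp : ∀ {X Y Z : C} (f g : X ⟶ Y) (h : Y ⟶ Z), (f * g) ≫ h = (f ≫ h) * (g ≫ h)
  isFilt_precomp : ∀ {X Y : C} (Z : C) (f : X ⟶ Y), IsFilt fun g : Y ⟶ Z => f ≫ g
  exists_copower : ∀ (Y : C) (m : ℕ), ∃ (K : C) (ι : Fin m → (Y ⟶ K)) (π : Fin m → (K ⟶ Y)),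
    (∀ i (g h : K ⟶ Y), ι i ≫ (g * h) = (ι i ≫ g) * (ι i ≫ h)) ∧
    ∀ i j, ι i ≫ π j = if i = j then 𝟙 Y else 0

theorem list_prod_of_sub_one_mem {M : Type*} [Monoid M] {ι : Type*} (p : ι → M) (l : List ι) :
    (l.map fun i => of (p i) - 1).prod ∈ augIdeal M ^ l.length := by
  induction l with
  | nil => exact mem_pow_zero
  | cons i l ih =>
    rw [List.map_cons, List.prod_cons, List.length_cons, Ideal.IsTwoSided.pow_succ]
    exact Ideal.mul_mem_mul (of_sub_one_mem _) ih

theorem list_prod_map_ite {M : Type*} [Monoid M] {ι : Type*} [DecidableEq ι] (e : M) (i : ι)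
    {l : List ι} (hl : l.Nodup) :
    (l.map fun j => if i = j then e else 1).prod = if i ∈ l then e else 1 := by
  induction l with
  | nil => simp
  | cons j l ih =>
    rw [List.nodup_cons] at hl
    rw [List.map_cons, List.prod_cons, ih hl.2]
    by_cases h : i = j
    · subst h; simp [hl.1]
    · simp [h]

/-- Modulo elements that some `φ k` sends to `1`, the product of the `p i - 1` is the product of the
`p i`. -/
theorem list_prod_of_sub_one_sub_mem {M N ι : Type*} [Monoid M] [Monoid N] (φ : ι → M →* N)
    (p : ι → M) (h : ∀ i j, i ≠ j → φ i (p j) = 1) {l : List ι} (hl : l.Nodup) :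
    (l.map fun i => of (p i) - 1).prod - of (l.map p).prod
      ∈ AddSubgroup.closure {y | ∃ k ∈ l, ∃ m, φ k m = 1 ∧ y = of m} := by
  induction l with
  | nil => simp [FreeAbelianGroup.one_def]
  | cons i l ih =>
    rw [List.nodup_cons] at hl
    set S := AddSubgroup.closure {y | ∃ k ∈ i :: l, ∃ m, φ k m = 1 ∧ y = of m} with hS
    have ih := ih hl.2
    -- As `i ∉ l`, every factor of this product is sent to `1` by `φ i`.
    have h₁ : of (l.map p).prod ∈ S := by
      refine AddSubgroup.subset_closure ⟨i, by simp, _, ?_, rfl⟩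
      rw [map_list_prod, List.map_map]
      refine List.prod_eq_one fun x hx => ?_
      obtain ⟨j, hj, rfl⟩ := List.mem_map.1 hx
      exact h i j fun e => hl.1 (e ▸ hj)
    have h₂ : ∀ y ∈ AddSubgroup.closure {y | ∃ k ∈ l, ∃ m, φ k m = 1 ∧ y = of m}, y ∈ S :=
      AddSubgroup.closure_mono fun y ⟨k, hk, hy⟩ => ⟨k, List.mem_cons_of_mem _ hk, hy⟩
    have h₃ : ∀ y ∈ AddSubgroup.closure {y | ∃ k ∈ l, ∃ m, φ k m = 1 ∧ y = of m},
        of (p i) * y ∈ S := by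
      intro y hy
      refine (AddSubgroup.closure_le (S.comap (AddMonoidHom.mulLeft (of (p i))))).2 ?_ hy
      rintro _ ⟨k, hk, m, hm, rfl⟩
      refine AddSubgroup.subset_closure ⟨k, List.mem_cons_of_mem _ hk, p i * m, ?_, ?_⟩
      · rw [map_mul, hm, mul_one]
        exact h k i fun e => hl.1 (e ▸ hk)
      · exact (FreeAbelianGroup.of_mul _ _).symm
    rw [List.map_cons, List.prod_cons, List.map_cons, List.prod_cons, FreeAbelianGroup.of_mul]
    generalize (l.map fun i => of (p i) - 1).prod = P at ih ⊢
    -- With `Q` the product over `l`, the difference `(p_i - 1)P - p_i Q` is split into `p_i(P -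
    -- Q)`, `-(P - Q)` and `-Q`. The first two come from the induction hypothesis and the third from
    -- `h₁`.
    have e : (of (p i) - 1) * P - of (p i) * of (l.map p).prod
        = of (p i) * (P - of (l.map p).prod) - (P - of (l.map p).prod) - of (l.map p).prod := by
      noncomm_ring
    rw [e]
    exact sub_mem (sub_mem (h₃ _ ih) (h₂ _ ih)) h₁

theorem univFunctor_map_mk (X : C) {Y Z : C} (g : Y ⟶ Z) (x : FreeAbelianGroup (X ⟶ Y)) :
    ((univFunctor X).map g).hom (QuotientAddGroup.mk x : FreeAbelianGroup (X ⟶ Y) ⧸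
      AddSubgroup.zmultiples (of (0 : X ⟶ Y))) = (QuotientAddGroup.mk (map (fun f => f ≫ g) x) :
        FreeAbelianGroup (X ⟶ Z) ⧸ AddSubgroup.zmultiples (of (0 : X ⟶ Z))) :=
  congrArg _ (zcomp_of_right x g)

theorem eq_aug_smul_of_mem_zmultiples {A : Type*} {a : A} {x : FreeAbelianGroup A}
    (hx : x ∈ AddSubgroup.zmultiples (of a)) : x = aug A x • of a := by
  obtain ⟨k, rfl⟩ := AddSubgroup.mem_zmultiples_iff.1 hx
  simp

variable [HasFiniteCoproducts C] [∀ X Y : C, Monoid (X ⟶ Y)]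

/-- Postcomposition, as a homomorphism. -/
def IsPointwise.postcomp (hC : IsPointwise C) (X : C) {Y Z : C} (g : Y ⟶ Z) :
    (X ⟶ Y) →* (X ⟶ Z) where
  toFun f := f ≫ g
  map_one' := by rw [hC.one_eq_zero, hC.one_eq_zero, zero_comp]
  map_mul' f f' := hC.mul_comp f f' g

/-- The folding map is the product `q` of the projections `π_i`. Expanding `P = ∏ (π_i - 1)` shows
that `P - q` is a combination of maps trivial on some summand, and `z` is killed by these. Thus
folding `z` amounts to composing it with `P ∈ I^{n+1}`, and precomposition preserves the filtration.
-/
theorem IsPointwise.map_fold_mem (hC : IsPointwise C) {n : ℕ} {X Y : C}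
    {z : FreeAbelianGroup (X ⟶ ∐ fun _ : Fin (n + 1) => Y)}
    (hz : ∀ k, map (fun f => f ≫ omitMap (fun _ : Fin (n + 1) => Y) k) z = 0) :
    map (fun f => f ≫ Sigma.desc fun _ => 𝟙 Y) z ∈ augIdeal (X ⟶ Y) ^ (n + 1) := by
  -- The monoid computation takes place in `Hom(K, Y)`, because precomposition with an inclusion is
  -- known to be multiplicative for `K` and not for the chosen coproduct. The map `s` below
  -- transports `z` to `K`.
  obtain ⟨K, ι, π, hι, hπ⟩ := hC.exists_copower Y (n + 1)
  let φ : Fin (n + 1) → (K ⟶ Y) →* (Y ⟶ Y) := fun i =>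
    { toFun := fun h => ι i ≫ h
      map_one' := by rw [hC.one_eq_zero, hC.one_eq_zero, comp_zero]
      map_mul' := hι i }
  have hφ : ∀ i j, φ i (π j) = if i = j then 𝟙 Y else 1 := fun i j => by
    rw [hC.one_eq_zero]; exact hπ i j
  let s : (∐ fun _ : Fin (n + 1) => Y) ⟶ K := Sigma.desc ι
  let l := List.finRange (n + 1)
  have hl : l.Nodup := List.nodup_finRange _
  let P : FreeAbelianGroup (K ⟶ Y) := (l.map fun i => of (π i) - 1).prod
  let q : K ⟶ Y := (l.map π).prod
  have hP : P ∈ augIdeal (K ⟶ Y) ^ (n + 1) := by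
    have := list_prod_of_sub_one_mem π l
    rwa [List.length_finRange] at this
  have hz' : ∀ h : K ⟶ Y, zcomp X K Y (map (fun f => f ≫ s) z) (of h)
      = map (fun f => f ≫ (s ≫ h)) z := fun h => by
    rw [zcomp_of_right, ← map_comp_apply]
    simp only [Function.comp_def, Category.assoc]
  have hker : P - of q ∈ (zcomp X K Y (map (fun f => f ≫ s) z)).ker := by
    refine (AddSubgroup.closure_le _).2 ?_ (list_prod_of_sub_one_sub_mem φ π
      (fun i j hij => by rw [hφ, if_neg hij]) hl)
    rintro _ ⟨k, -, h, hh, rfl⟩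
    change zcomp X K Y (map (fun f => f ≫ s) z) (of h) = 0
    -- A map trivial on the `k`-th summand factors through the retraction that omits this summand.
    have e : s ≫ h = omitMap (fun _ : Fin (n + 1) => Y) k ≫
        Sigma.desc fun j => ι (k.succAbove j) ≫ h := by
      refine Sigma.hom_ext _ _ fun i => ?_
      refine Fin.succAboveCases k ?_ (fun j => ?_) i
      · have : ι k ≫ h = 0 := hh.trans (hC.one_eq_zero _ _)
        simp [s, omitMap, this]
      · simp [s, omitMap]
    have hm := congrArg (map fun f => f ≫ Sigma.desc fun j => ι (k.succAbove j) ≫ h) (hz k)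
    rw [← map_comp_apply, map_zero] at hm
    rw [hz', e]
    simpa only [Function.comp_def, Category.assoc] using hm
  -- On the `i`-th summand exactly one factor of `q` restricts to the identity and the others
  -- restrict to `1`.
  have hq : s ≫ q = Limits.Sigma.desc fun _ => 𝟙 Y := by
    refine Sigma.hom_ext _ _ fun i => ?_
    have : ι i ≫ q = 𝟙 Y := by
      change φ i q = 𝟙 Y
      rw [map_list_prod, List.map_map]
      simp only [Function.comp_def, hφ]
      rw [list_prod_map_ite _ _ hl, if_pos (List.mem_finRange i)]
    simpa [s] using this
  have hfold : map (fun f => f ≫ Sigma.desc fun _ => 𝟙 Y) z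
      = zcomp X K Y (map (fun f => f ≫ s) z) P := by
    rw [← hq, ← hz', ← sub_eq_zero, ← map_sub, ← neg_sub, map_neg, neg_eq_zero]
    exact hker
  rw [hfold]
  generalize map (fun f => f ≫ s) z = w
  induction w using FreeAbelianGroup.induction_on with
  | zero => rw [map_zero]; exact zero_mem _
  | neg _ ih => rw [map_neg]; exact neg_mem ih
  | add _ _ h1 h2 => rw [map_add]; exact add_mem h1 h2
  | of f => rw [zcomp_of_left]; exact hC.isFilt_precomp Y f _ P hP

/-- A product `(x₀ - 1)⋯(x_{s-1} - 1)y` is lifted by sending each factor to a summand of its own.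
Omitting that summand turns the factor into `0`, and folding restores the product. The bound `k < s`
records which summands are already used, and at `s = n + 1` the lift lies in the cross-effect. -/
theorem IsPointwise.exists_map_fold_eq (hC : IsPointwise C) {n : ℕ} {X Y : C} {s : ℕ}
    (hs : s ≤ n + 1) {y : FreeAbelianGroup (X ⟶ Y)} (hy : y ∈ augIdeal (X ⟶ Y) ^ s) :
    ∃ z : FreeAbelianGroup (X ⟶ ∐ fun _ : Fin (n + 1) => Y),
      (∀ k : Fin (n + 1), k < s → map (fun f => f ≫ omitMap (fun _ : Fin (n + 1) => Y) k) z = 0) ∧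
      map (fun f => f ≫ Sigma.desc fun _ => 𝟙 Y) z = y := by
  induction s generalizing y with
  | zero =>
    refine ⟨map (fun f => f ≫ Sigma.ι (fun _ : Fin (n + 1) => Y) 0) y,
      fun k hk => absurd hk (Nat.not_lt_zero _), ?_⟩
    rw [← map_comp_apply]
    simp only [Function.comp_def, Category.assoc, colimit.ι_desc, Cofan.mk_ι_app, Category.comp_id]
    exact map_id_apply y
  | succ s ih =>
    let S : AddSubgroup (FreeAbelianGroup (X ⟶ Y)) :=
      (⨅ k : {k : Fin (n + 1) // k < s + 1},
        (map fun f : X ⟶ _ => f ≫ omitMap (fun _ : Fin (n + 1) => Y) k).ker).map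
        (map fun f => f ≫ Sigma.desc fun _ => 𝟙 Y)
    suffices h : y ∈ S by
      obtain ⟨z, hz, e⟩ := h
      exact ⟨z, fun k hk => AddSubgroup.mem_iInf.1 hz ⟨k, hk⟩, e⟩
    refine pow_succ_induction S (fun x w hw => ?_) hy
    obtain ⟨z, hz, e⟩ := ih (by omega) hw
    -- Summand `s` is the next one to be used. The new factor dies under its omission, while the
    -- omissions `k < s` are multiplicative and still kill `z`.
    let i : Fin (n + 1) := ⟨s, by omega⟩
    have hmul : ∀ {Z : C} (g : (∐ fun _ : Fin (n + 1) => Y) ⟶ Z),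
        map (fun f => f ≫ g) ((of (x ≫ Sigma.ι (fun _ : Fin (n + 1) => Y) i) - 1) * z)
          = (of (x ≫ Sigma.ι (fun _ : Fin (n + 1) => Y) i ≫ g) - 1) * map (fun f => f ≫ g) z := by
      intro Z g
      refine (map_mul_of_hom (hC.postcomp X g) _ _).trans ?_
      rw [map_sub, FreeAbelianGroup.one_def, map_of_apply, map_of_apply, map_one]
      simp [IsPointwise.postcomp, FreeAbelianGroup.one_def]
    refine ⟨(of (x ≫ Sigma.ι (fun _ : Fin (n + 1) => Y) i) - 1) * z,
      AddSubgroup.mem_iInf.2 fun ⟨k, hk⟩ => ?_, ?_⟩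
    · refine (hmul _).trans ?_
      by_cases h : (k : ℕ) < s
      · rw [hz k h, mul_zero]
      · obtain rfl : k = i := Fin.ext (by change (k : ℕ) = s; omega)
        have h0 : Sigma.ι (fun _ : Fin (n + 1) => Y) i ≫ omitMap (fun _ : Fin (n + 1) => Y) i = 0 := by
          simp [omitMap]
        rw [h0, comp_zero, ← hC.one_eq_zero, ← FreeAbelianGroup.one_def, sub_self, zero_mul]
    · refine (hmul _).trans ?_
      rw [e]
      simp

/-- The class of `x` modulo `ℤ·0` has a unique representative of augmentation zero, namely `x - ε(x)
0`, and the two preceding lemmas are applied to it. -/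
theorem IsPointwise.mk_mem_taylorKer_iff (hC : IsPointwise C) {n : ℕ} {X Y : C}
    (x : FreeAbelianGroup (X ⟶ Y)) :
    (QuotientAddGroup.mk x : FreeAbelianGroup (X ⟶ Y) ⧸ AddSubgroup.zmultiples (of (0 : X ⟶ Y)))
      ∈ (taylorKer (univFunctor X) n Y : AddSubgroup (FreeAbelianGroup (X ⟶ Y) ⧸
          AddSubgroup.zmultiples (of (0 : X ⟶ Y)))) ↔
      x - aug _ x • of 0 ∈ augIdeal (X ⟶ Y) ^ (n + 1) := by
  constructor
  · rintro ⟨z, hz, e⟩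
    obtain ⟨z, rfl⟩ : ∃ z' : FreeAbelianGroup (X ⟶ ∐ fun _ : Fin (n + 1) => Y),
        (QuotientAddGroup.mk z' : FreeAbelianGroup (X ⟶ _) ⧸
          AddSubgroup.zmultiples (of (0 : X ⟶ _))) = z := QuotientAddGroup.mk_surjective z
    replace e := (univFunctor_map_mk X _ z).symm.trans e
    have h₁ : ∀ k, map (fun f => f ≫ omitMap (fun _ : Fin (n + 1) => Y) k) z
        = aug _ z • of 0 := fun k => by
      have := (univFunctor_map_mk X _ z).symm.trans (AddSubgroup.mem_iInf.1 hz k)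
      have := eq_aug_smul_of_mem_zmultiples ((QuotientAddGroup.eq_zero_iff _).1 this)
      rwa [aug_map] at this
    have h₂ := eq_aug_smul_of_mem_zmultiples (QuotientAddGroup.eq.1 e)
    -- In `U_X` the omissions kill `z` only modulo `ℤ·0`. Since they preserve augmentations,
    -- subtracting `ε(z) 0` makes them vanish exactly.
    have h₃ := hC.map_fold_mem (z := z - aug _ z • of 0) fun k => by
      rw [map_sub, h₁, map_zsmul, map_of_apply, zero_comp, sub_self]
    rw [map_sub, map_zsmul, map_of_apply, zero_comp] at h₃
    convert h₃ using 1
    rw [map_add, map_neg, aug_map, add_smul, neg_smul, neg_add_eq_iff_eq_add] at h₂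
    rw [sub_eq_iff_eq_add]
    exact h₂.trans (by abel)
  · intro hx
    obtain ⟨z, hz, e⟩ := hC.exists_map_fold_eq (n := n) le_rfl hx
    refine ⟨(QuotientAddGroup.mk z : FreeAbelianGroup (X ⟶ _) ⧸
      AddSubgroup.zmultiples (of (0 : X ⟶ _))), AddSubgroup.mem_iInf.2 fun k => ?_, ?_⟩
    · refine (univFunctor_map_mk X _ z).trans ?_
      rw [hz k k.2]
      rfl
    · refine (univFunctor_map_mk X _ z).trans ?_
      rw [e]
      refine QuotientAddGroup.eq.2 (AddSubgroup.mem_zmultiples_iff.2 ⟨aug _ x, ?_⟩)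
      abel

end Taylor

/-! ## The comparison of `T_n ℤ̄[C]` with quotients of the augmentation category -/

section Comparison

universe v u

open FreeAbelianGroup

variable {C : Type u} [Category.{v} C] [HasZeroMorphisms C] [HasFiniteCoproducts C]
  [∀ X Y : C, Monoid (X ⟶ Y)]

theorem IsPointwise.mem_taylorIdeal_iff (hC : IsPointwise C) (n : ℕ) {X Y : ZRed C} (f : X ⟶ Y) :
    f ∈ (taylorIdeal C n).carrier X Y ↔
      ((zredToAug C).map f).1 ∈ augIdeal (X.obj.obj ⟶ Y.obj.obj) ^ (n + 1) := by
  obtain ⟨x, rfl⟩ := QuotCat.map_proj_surjective f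
  exact hC.mk_mem_taylorKer_iff x

/-- The composite `ℤ̄[C] → AugCat C → QuotCat L` is full, because an element of `I` is the image of
its own class, and its kernel is the Taylor ideal. It therefore descends to an isomorphism. -/
theorem IsPointwise.exists_isPreaddIso (hC : IsPointwise C) (n : ℕ) {L : AddIdeal (AugCat C)}
    (hL : ∀ {X Y : AugCat C} (f : X ⟶ Y),
      f ∈ L.carrier X Y ↔ f.1 ∈ augIdeal (X.obj ⟶ Y.obj) ^ (n + 1)) :
    ∃ Φ : TZ C n ⥤ QuotCat L,
      IsPreaddIso Φ ∧ tFunctor C n ⋙ Φ = augFunctor C ⋙ QuotCat.proj L := by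
  have h : ∀ {X Y : ZRed C} (f : X ⟶ Y), (zredToAug C ⋙ QuotCat.proj L).map f = 0 ↔
      f ∈ (taylorIdeal C n).carrier X Y := fun f =>
    (QuotCat.map_proj_eq_zero_iff ((zredToAug C).map f)).trans
      ((hL _).trans (hC.mem_taylorIdeal_iff n f).symm)
  refine ⟨QuotCat.lift (zredToAug C ⋙ QuotCat.proj L) fun f => (h f).2,
    QuotCat.isPreaddIso_lift _ h (fun {X Y} g => ?_) (fun X => ⟨⟨X.obj.obj⟩⟩) (fun _ => rfl)
      fun _ => rfl, ?_⟩
  · obtain ⟨g, rfl⟩ := QuotCat.map_proj_surjective g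
    exact ⟨(QuotCat.proj (zeroIdeal C)).map (X := X.obj) (Y := Y.obj) g.1,
      congrArg (QuotCat.proj L).map (zcatToAug_map_val g)⟩
  · rw [← zredFunctor_comp_zredToAug]
    rfl

end Comparison

/-! ### Pointwise structures on the morphism sets of `mon` and `gr` -/

section Pointwise

attribute [local instance] monHomMonoid grpHomGroup

/-- The copower of `Y` is free on `m` blocks of letters, and the `j`-th projection sends every other
block to `1`. Precomposition need not be multiplicative, but its components are words in evaluation
homomorphisms, which preserve the filtration. -/
theorem FMon.isPointwise : IsPointwise FMon where
  one_eq_zero _ _ := FMon.hom_ext fun i => FMon.one_apply i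
  mul_comp f g h := FMon.hom_ext fun i =>
    (congrArg (FMon.hom h) (FMon.mul_apply f g i)).trans <|
      (map_mul (FMon.hom h) _ _).trans (FMon.mul_apply (f ≫ h) (g ≫ h) i).symm
  isFilt_precomp Z f := by
    intro t y hy
    -- The operadic description covers only exponents `t + 1`, and exponent zero imposes no
    -- condition.
    cases t with
    | zero => exact mem_pow_zero
    | succ t =>
      exact (mem_opPow_monOp _ _ t _).1
        (FMon.precomp_mem t f y ((mem_opPow_monOp _ _ t _).2 hy))
  exists_copower Y m := by
    let K : FMon := ⟨m * Y.rank⟩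
    let ι : Fin m → (Y ⟶ K) := fun i =>
      FMon.mk' (FreeMonoid.lift fun j => FreeMonoid.of (finProdFinEquiv (i, j)))
    have hι : ∀ i (Z : FMon) (g : K ⟶ Z) j, FMon.hom (ι i ≫ g) (FreeMonoid.of j)
        = FMon.hom g (FreeMonoid.of (finProdFinEquiv (i, j))) := fun i Z g j =>
      congrArg (FMon.hom g) (FreeMonoid.lift_eval_of _ _)
    refine ⟨K, ι, fun j => FMon.mk' (FreeMonoid.lift fun p =>
      if (finProdFinEquiv.symm p).1 = j then FreeMonoid.of (finProdFinEquiv.symm p).2 else 1),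
      fun i g h => FMon.hom_ext fun j => ?_, fun i j => FMon.hom_ext fun k => ?_⟩
    · rw [hι, FMon.mul_apply, FMon.mul_apply, hι, hι]
    · rw [hι]
      refine (FreeMonoid.lift_eval_of _ _).trans ?_
      rw [Equiv.symm_apply_apply]
      split_ifs <;> rfl

theorem FGrp.isPointwise : IsPointwise FGrp where
  one_eq_zero _ _ := FGrp.hom_ext fun i => FGrp.one_apply i
  mul_comp f g h := FGrp.hom_ext fun i =>
    (congrArg (FGrp.hom h) (FGrp.mul_apply f g i)).trans <|
      (map_mul (FGrp.hom h) _ _).trans (FGrp.mul_apply (f ≫ h) (g ≫ h) i).symm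
  isFilt_precomp Z f := by
    intro t y hy
    cases t with
    | zero => exact mem_pow_zero
    | succ t =>
      exact (mem_opPow_grpOp _ _ t _).1
        (FGrp.precomp_mem t f y ((mem_opPow_grpOp _ _ t _).2 hy))
  exists_copower Y m := by
    let K : FGrp := ⟨m * Y.rank⟩
    let ι : Fin m → (Y ⟶ K) := fun i =>
      FGrp.mk' (FreeGroup.lift fun j => FreeGroup.of (finProdFinEquiv (i, j)))
    have hι : ∀ i (Z : FGrp) (g : K ⟶ Z) j, FGrp.hom (ι i ≫ g) (FreeGroup.of j)
        = FGrp.hom g (FreeGroup.of (finProdFinEquiv (i, j))) := fun i Z g j =>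
      congrArg (FGrp.hom g) FreeGroup.lift_apply_of
    refine ⟨K, ι, fun j => FGrp.mk' (FreeGroup.lift fun p =>
      if (finProdFinEquiv.symm p).1 = j then FreeGroup.of (finProdFinEquiv.symm p).2 else 1),
      fun i g h => FGrp.hom_ext fun j => ?_, fun i j => FGrp.hom_ext fun k => ?_⟩
    · rw [hι, FGrp.mul_apply, FGrp.mul_apply, hι, hι]
    · rw [hι]
      refine FreeGroup.lift_apply_of.trans ?_
      rw [Equiv.symm_apply_apply]
      split_ifs <;> rfl

end Pointwise

/-! ## The functor induced by groupification -/

section AugMap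

universe v u v' u'

open FreeAbelianGroup

variable {C : Type u} [Category.{v} C] {D : Type u'} [Category.{v'} D]

theorem map_zcomp (F : C ⥤ D) {X Y Z : C} (x : FreeAbelianGroup (X ⟶ Y))
    (y : FreeAbelianGroup (Y ⟶ Z)) :
    map (fun f => F.map f) (zcomp X Y Z x y)
      = zcomp _ _ _ (map (fun f => F.map f) x) (map (fun f => F.map f) y) := by
  induction x using FreeAbelianGroup.induction_on with
  | zero => simp
  | neg _ ih => simp only [map_neg, AddMonoidHom.neg_apply, ih]
  | add _ _ h1 h2 => simp only [map_add, AddMonoidHom.add_apply, h1, h2]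
  | of f =>
    rw [zcomp_of_left, map_of_apply, zcomp_of_left, ← map_comp_apply, ← map_comp_apply]
    simp only [Function.comp_def, F.map_comp]

variable [HasZeroMorphisms C] [HasZeroMorphisms D]

/-- The additive functor between augmentation categories induced by a functor which preserves zero
morphisms. -/
def augCatMap (F : C ⥤ D) [F.PreservesZeroMorphisms] : AugCat C ⥤ AugCat D where
  obj X := ⟨F.obj X.obj⟩
  map {X Y} f := ⟨map (fun g => F.map g) f.1, by rw [mem_augKer, aug_map]; exact f.2⟩
  map_id X := Subtype.ext <| by
    change map (fun g => F.map g) (of (𝟙 X.obj) - of 0) = of (𝟙 (F.obj X.obj)) - of 0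
    simp
  map_comp f g := Subtype.ext (map_zcomp F f.1 g.1)

variable (F : C ⥤ D) [F.PreservesZeroMorphisms]

instance : (augCatMap F).Additive where
  map_add {_ _ f g} := Subtype.ext (map_add (map fun g => F.map g) f.1 g.1)

theorem augFunctor_comp_augCatMap : augFunctor C ⋙ augCatMap F = F ⋙ augFunctor D := by
  refine Functor.hext (fun _ => rfl) fun X Y f => heq_of_eq (Subtype.ext ?_)
  change map (fun g : X ⟶ Y => F.map g) (of f - of 0)
    = (of (F.map f) - of 0 : FreeAbelianGroup (F.obj X ⟶ F.obj Y))
  simp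

end AugMap

/-! ### The isomorphism `P_n g` and its uniqueness -/

section MonGrp

open FreeAbelianGroup

attribute [local instance] monHomMonoid grpHomGroup

instance : groupification.PreservesZeroMorphisms where
  map_zero X Y := by
    rw [← FMon.isPointwise.one_eq_zero, ← FGrp.isPointwise.one_eq_zero]
    exact map_one (groupificationHom X Y)

theorem augCatMap_mem_iff (n : ℕ) {X Y : FMon} (x : FreeAbelianGroup (X ⟶ Y)) :
    map (fun f => groupification.map f) x
      ∈ opPow (grpOp (groupification.obj X) (groupification.obj Y)) (n + 1) ↔
      x ∈ opPow (monOp X Y) (n + 1) := by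
  rw [mem_opPow_grpOp, mem_opPow_monOp]
  exact (isGroupification_groupificationHom X Y).map_mem_pow_iff (n + 1) x

/-- The two halves of `ℤ[M]/I(M)^{n+1} ≅ ℤ[G]/I(G)^{n+1}` enter separately: `augCatMap_mem_iff`
identifies the kernel, and `exists_mem_augKer` gives fullness. -/
theorem exists_isPreaddIso_pMon_pGrp (n : ℕ) :
    ∃ P : PMon n ⥤ PGrp n, IsPreaddIso P ∧ pMon n ⋙ P = groupification ⋙ pGrp n := by
  have h : ∀ {X Y : AugCat FMon} (f : X ⟶ Y),
      (augCatMap groupification ⋙ QuotCat.proj (passiIdeal grpOp n (fun f => FGrp.precomp_mem n f)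
        fun g => FGrp.postcomp_mem n g)).map f = 0 ↔
      f ∈ (passiIdeal monOp n (fun f => FMon.precomp_mem n f)
        fun g => FMon.postcomp_mem n g).carrier X Y := fun f =>
    (QuotCat.map_proj_eq_zero_iff ((augCatMap groupification).map f)).trans
      (augCatMap_mem_iff n f.1)
  refine ⟨QuotCat.lift _ fun f => (h f).2, QuotCat.isPreaddIso_lift _ h (fun {X Y} g => ?_)
    (fun X => ⟨⟨X.obj.obj.rank⟩⟩) (fun _ => rfl) fun _ => rfl, ?_⟩
  · obtain ⟨g, rfl⟩ := QuotCat.map_proj_surjective g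
    obtain ⟨x, hx0, hx⟩ := (isGroupification_groupificationHom X.obj Y.obj).exists_mem_augKer
      n g.2
    refine ⟨⟨x, hx0⟩, ?_⟩
    refine QuotientAddGroup.eq_iff_sub_mem.2 ?_
    exact (mem_opPow_grpOp _ _ n _).2 hx
  · exact congrArg (· ⋙ QuotCat.proj (passiIdeal grpOp n (fun f => FGrp.precomp_mem n f)
      fun g => FGrp.postcomp_mem n g)) (augFunctor_comp_augCatMap groupification)

end MonGrp

/-- The classes `p_n(f)` generate the morphism groups, whence the uniqueness of `P_n g`. -/
theorem pMon_functor_ext {n : ℕ} {E : Type*} [Category E] [Preadditive E] {Q Q' : PMon n ⥤ E}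
    [Q.Additive] [Q'.Additive] (h : pMon n ⋙ Q = pMon n ⋙ Q') : Q = Q' :=
  QuotCat.functor_ext (AugCat.functor_ext h)

end PolyFun

theorem mainTheorem7 (n : ℕ) :
    ∃ (Pg : PMon n ⥤ PGrp n) (Tg : TZ FMon n ⥤ TZ FGrp n)
      (Φ : TZ FMon n ⥤ PMon n) (Ψ : TZ FGrp n ⥤ PGrp n),
      -- `g` induces the isomorphism of preadditive categories `P_n g`, and it is determined by `g`
      (IsPreaddIso Pg ∧ pMon n ⋙ Pg = groupification ⋙ pGrp n ∧
        ∀ Q : PMon n ⥤ PGrp n, Q.Additive → pMon n ⋙ Q = groupification ⋙ pGrp n → Q = Pg) ∧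
      -- the induced isomorphism between the Taylorised categories
      (IsPreaddIso Tg ∧ tFunctor FMon n ⋙ Tg = groupification ⋙ tFunctor FGrp n) ∧
      -- the two isomorphisms correspond to each other under the canonical identifications
      (IsPreaddIso Φ ∧ tFunctor FMon n ⋙ Φ = pMon n) ∧
      (IsPreaddIso Ψ ∧ tFunctor FGrp n ⋙ Ψ = pGrp n) ∧
      Φ ⋙ Pg = Tg ⋙ Ψ := by
  let _ := monHomMonoid
  let _ := grpHomGroup
  obtain ⟨Pg, hPg, hp⟩ := exists_isPreaddIso_pMon_pGrp n
  obtain ⟨Φ, hΦ, ht⟩ := FMon.isPointwise.exists_isPreaddIso n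
    (L := passiIdeal monOp n (fun f => FMon.precomp_mem n f) fun g => FMon.postcomp_mem n g)
    fun f => mem_opPow_monOp _ _ n f.1
  obtain ⟨Ψ, hΨ, ht'⟩ := FGrp.isPointwise.exists_isPreaddIso n
    (L := passiIdeal grpOp n (fun f => FGrp.precomp_mem n f) fun g => FGrp.postcomp_mem n g)
    fun f => mem_opPow_grpOp _ _ n f.1
  obtain ⟨Ψ', hΨ', h₁, h₂⟩ := hΨ.exists_inverse
  have := hPg.1
  have htΦ : tFunctor FMon n ⋙ Φ = pMon n := ht
  have htΨ : tFunctor FGrp n ⋙ Ψ = pGrp n := ht'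
  -- Taking `T_n g` to be `P_n g` transported along `Φ` and the inverse of `Ψ` makes the last square
  -- commute by construction. Compatibility with `t_n` then follows from those of `Φ`, `P_n g` and
  -- `Ψ`.
  refine ⟨Pg, Φ ⋙ Pg ⋙ Ψ', Φ, Ψ, ⟨hPg, hp, fun Q _ hQ => pMon_functor_ext (hQ.trans hp.symm)⟩,
    ⟨hΦ.comp (hPg.comp hΨ'), ?_⟩, ⟨hΦ, htΦ⟩, ⟨hΨ, htΨ⟩, ?_⟩
  · rw [← Functor.assoc, htΦ, ← Functor.assoc, hp, ← htΨ, Functor.assoc, Functor.assoc, h₁,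
      Functor.comp_id]
  · rw [Functor.assoc, Functor.assoc, h₂, Functor.comp_id]
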